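/- Let $f(n,m)$ be the expectation of $\max F$, where $F$ is a uniformly random 2-SAT formula with $n$ variables and $m$ clauses (the $m$ clauses are drawn independently and uniformly, with replacement, from the $4\binom n2$ clauses consisting of two literals on two distinct variables), and $\max F$ is the maximum, over all truth assignments, of the number of clauses of $F$ (counted with repetition) that are satisfied. Then for $c=1-\varepsilon$, with any constant $0<\varepsilon<1$, $$\lfloor cn\rfloor-f(n,\lfloor cn\rfloor)=\Theta\!\left(\frac1{\varepsilon^3 n}\right)\qquad(n\to\infty),$$ where the implicit constants do not depend on $\varepsilon$ as long as $\varepsilon$ stays away from $1$. Precisely: there is an absolute constant $A>0$ such that for every $\varepsilon_1\in(0,1)$ there is a constant $a>0$, depending only on $\varepsilon_1$, such that for every $\varepsilon\in(0,\varepsilon_1]$ there is an $n_0$ such that for all $n\ge n_0$ $$\frac{a}{\varepsilon^3 n}\;\le\;\lfloor (1-\varepsilon)n\rfloor-f\bigl(n,\lfloor (1-\varepsilon)n\rfloor\bigr)\;\le\;\frac{A}{\varepsilon^3 n}.$$ -/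

import Mathlib

namespace Max2Sat

/-- A literal on the variables `0, …, n-1`: the pair `(v, b)` stands for the variable `v`
if `b = true`, and for its complement if `b = false`. -/
abbrev Literal (n : ℕ) : Type := Fin n × Bool

/-- A proper 2-clause: an unordered set of two literals on two distinct variables.
There are `4 * (n choose 2)` of them. -/
abbrev Clause (n : ℕ) : Type :=
  {C : Finset (Literal n) // C.card = 2 ∧ (C.image Prod.fst).card = 2}

/-- A 2-SAT formula with `n` variables and `m` clauses; clauses may be repeated. -/
abbrev Formula (n m : ℕ) : Type := Fin m → Clause n

/-- The assignment `X` satisfies the clause `C`: some literal of `C` is true under `X`. -/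
def Satisfies {n : ℕ} (X : Fin n → Bool) (C : Clause n) : Prop :=
  ∃ l ∈ C.1, X l.1 = l.2

instance {n : ℕ} (X : Fin n → Bool) (C : Clause n) : Decidable (Satisfies X C) := by
  unfold Satisfies
  infer_instance

/-- `F(X)`: the number of clauses of `F`, counted with repetition, that `X` satisfies. -/
def numSat {n m : ℕ} (F : Formula n m) (X : Fin n → Bool) : ℕ :=
  (Finset.univ.filter fun i : Fin m => Satisfies X (F i)).card

/-- `max F`: the largest number of clauses of `F` that some assignment satisfies. -/
def maxSat {n m : ℕ} (F : Formula n m) : ℕ :=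
  Finset.univ.sup fun X : Fin n → Bool => numSat F X

/-- `f(n, m)`: the expectation of `max F` for a formula `F` chosen uniformly at random from all
formulas with `n` variables and `m` clauses, that is, with `m` clauses drawn independently and
uniformly, with replacement, from the proper 2-clauses. (For `n ≥ 2` there is such a formula.) -/
noncomputable def f (n m : ℕ) : ℝ :=
  (∑ F : Formula n m, (maxSat F : ℝ)) / (Fintype.card (Formula n m) : ℝ)

end Max2Sat

namespace Max2Sat

/-! Read a clause `¬a ∨ b` as implications `a → b` and `¬b → ¬a`. A bicycle is a walk of `s + 1`
distinct clauses through `s` variables, so the expected number of its occurrences in the formula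
carries a factor `1/n`. There are at most about `(2n)^s (2s)^2` bicycles, and with `m ≤ cn` clauses
out of `2n(n-1)` the expected number of those through `s` variables is of order `s^2 c^s / n`.
Summed over `s` this gives `1/(ε^3 n)`, since `∑ binom(k+2, 2) c^k = 1/(1-c)^3`.

Upper bound (`sub_f_le`): a clause set without bicycles is satisfiable
(`exists_satisfies_of_no_bicycle`). Giving up one clause from each bicycle present therefore
suffices, and the expected loss is at most the expected number of bicycles, counted with
multiplicity (`sub_maxSat_le`).

Lower bound (`le_card_sub_f`): a constant proportion of bicycles are contradictory and uniquely
encoded by their walks (`card_contradictorySets_ge`); the presence of a single one costs a clause.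
Only lengths up to a constant `K` are used, where `K` depends on `ε` and captures half of the
series. Two distinct bicycles together again have a surplus of clauses over variables
(`IsTight.card_vars_sdiff_lt`), so pairs contribute a further factor `O(1/n)` and a second moment
bound turns the expectation into a probability. -/

lemma succ_descFactorial_eq_add (m k : ℕ) :
    (m + 1).descFactorial (k + 1) = m.descFactorial (k + 1) + (k + 1) * m.descFactorial k := by
  rw [Nat.succ_descFactorial_succ, Nat.descFactorial_succ]
  rcases le_or_gt k m with h | h
  · obtain ⟨d, rfl⟩ := Nat.exists_eq_add_of_le h
    rw [Nat.add_sub_cancel_left]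
    ring
  · simp [Nat.descFactorial_eq_zero_iff_lt.2 h]

/-! ### Multiplicities and covering for finite sequences. -/

section Values

variable {α : Type*} [DecidableEq α]

/-- The number of times that `F` takes the value `c`. -/
def mult {m : ℕ} (F : Fin m → α) (c : α) : ℕ :=
  (Finset.univ.filter fun i => F i = c).card

lemma mult_cons {m : ℕ} (a c : α) (F : Fin m → α) :
    mult (Fin.cons a F : Fin (m + 1) → α) c = (if a = c then 1 else 0) + mult F c := by
  unfold mult
  rw [Finset.card_filter, Finset.card_filter, Fin.sum_univ_succ]
  simp

lemma prod_mult_cons {m : ℕ} (a : α) (F : Fin m → α) (S : Finset α) :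
    ∏ c ∈ S, (mult (Fin.cons a F : Fin (m + 1) → α) c : ℝ) =
      ∏ c ∈ S, (mult F c : ℝ) + if a ∈ S then ∏ c ∈ S.erase a, (mult F c : ℝ) else 0 := by
  split_ifs with h
  · rw [← Finset.mul_prod_erase S _ h, ← Finset.mul_prod_erase S (fun c => (mult F c : ℝ)) h,
      mult_cons, Finset.prod_congr rfl (g := fun c => (mult F c : ℝ))]
    · simp; ring
    · intro c hc
      rw [mult_cons, if_neg (Finset.ne_of_mem_erase hc).symm, zero_add]
  · rw [add_zero]
    refine Finset.prod_congr rfl fun c hc => ?_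
    rw [mult_cons, if_neg (by rintro rfl; exact h hc), zero_add]

/-- All elements of `S` are values of `F`. -/
def Covers {m : ℕ} (F : Fin m → α) (S : Finset α) : Prop := ∀ c ∈ S, ∃ i, F i = c

instance {m : ℕ} (F : Fin m → α) (S : Finset α) : Decidable (Covers F S) := by
  unfold Covers
  infer_instance

lemma one_le_prod_mult {m : ℕ} {F : Fin m → α} {S : Finset α} (h : Covers F S) :
    ∀ c ∈ S, 1 ≤ mult F c := by
  intro c hc
  obtain ⟨i, hi⟩ := h c hc
  exact Finset.card_pos.2 ⟨i, by simp [hi]⟩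

lemma covers_cons {m : ℕ} (a : α) (F : Fin m → α) (S : Finset α) :
    Covers (Fin.cons a F : Fin (m + 1) → α) S ↔ Covers F (S.erase a) := by
  unfold Covers
  simp only [Fin.exists_fin_succ, Fin.cons_zero, Fin.cons_succ, Finset.mem_erase]
  refine forall_congr' fun c => ?_
  by_cases h : a = c
  · simp [h]
  · simp [h, Ne.symm h]

lemma covers_union {m : ℕ} (F : Fin m → α) (S T : Finset α) :
    Covers F (S ∪ T) ↔ Covers F S ∧ Covers F T := by
  simp [Covers, or_imp, forall_and]

end Values

/-! ### Averages over uniformly random sequences. -/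

section Counting

variable {α : Type*} [Fintype α]

/-- The average of `g` over all functions `Fin m → α`. -/
noncomputable def avg (m : ℕ) (g : (Fin m → α) → ℝ) : ℝ :=
  (∑ F : Fin m → α, g F) / (Fintype.card α : ℝ) ^ m

lemma avg_succ (m : ℕ) (g : (Fin (m + 1) → α) → ℝ) :
    avg (m + 1) g = (∑ a : α, avg m fun F => g (Fin.cons a F)) / (Fintype.card α : ℝ) := by
  have h : ∑ F : Fin (m + 1) → α, g F = ∑ a : α, ∑ F : Fin m → α, g (Fin.cons a F) := by
    rw [← (Fin.consEquiv (fun _ => α)).sum_comp, Fintype.sum_prod_type]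
    rfl
  simp only [avg]
  rw [h, ← Finset.sum_div, div_div, pow_succ]

lemma avg_mono {m : ℕ} {g h : (Fin m → α) → ℝ} (H : ∀ F, g F ≤ h F) : avg m g ≤ avg m h := by
  unfold avg
  gcongr
  exact H _

lemma avg_add {m : ℕ} (g h : (Fin m → α) → ℝ) :
    avg m (fun F => g F + h F) = avg m g + avg m h := by
  simp [avg, Finset.sum_add_distrib, add_div]

lemma avg_sub {m : ℕ} (g h : (Fin m → α) → ℝ) :
    avg m (fun F => g F - h F) = avg m g - avg m h := by
  simp [avg, Finset.sum_sub_distrib, sub_div]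

lemma avg_sum {ι : Type*} {m : ℕ} (s : Finset ι) (g : ι → (Fin m → α) → ℝ) :
    avg m (fun F => ∑ i ∈ s, g i F) = ∑ i ∈ s, avg m (g i) := by
  simp only [avg]
  rw [Finset.sum_comm, Finset.sum_div]

lemma descFactorial_div_le [Nonempty α] (m k : ℕ) :
    (m.descFactorial k : ℝ) / (Fintype.card α : ℝ) ^ k ≤ ((m : ℝ) / Fintype.card α) ^ k := by
  rw [div_pow]
  gcongr
  exact_mod_cast Nat.descFactorial_le_pow m k

variable [DecidableEq α]

/-- The product counts the ways to choose, for every `c ∈ S`, a position with value `c`. Such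
positions are distinct, and each of the `m.descFactorial S.card` choices is realised with
probability `1 / N ^ S.card`, where `N` is the size of `α`. The induction splits off the first
entry. -/
lemma avg_prod_mult [Nonempty α] (m : ℕ) (S : Finset α) :
    avg m (fun F => ∏ c ∈ S, (mult F c : ℝ)) =
      (m.descFactorial S.card : ℝ) / (Fintype.card α : ℝ) ^ S.card := by
  have hN : (Fintype.card α : ℝ) ≠ 0 := by simp
  induction m generalizing S with
  | zero =>
    rcases S.eq_empty_or_nonempty with rfl | h
    · simp [avg]
    · obtain ⟨k, hk⟩ := Nat.exists_eq_succ_of_ne_zero h.card_pos.ne'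
      obtain ⟨c, hc⟩ := h
      simp [avg, hk, Finset.prod_eq_zero hc, mult]
  | succ m ih =>
    rw [avg_succ]
    simp only [prod_mult_cons]
    simp only [avg_add, ih, Finset.sum_add_distrib]
    have h1 : ∑ a : α, avg m (fun F : Fin m → α =>
        if a ∈ S then ∏ c ∈ S.erase a, (mult F c : ℝ) else 0) =
        ∑ a ∈ S, (m.descFactorial (S.card - 1) : ℝ) / (Fintype.card α : ℝ) ^ (S.card - 1) := by
      rw [← Finset.sum_filter_add_sum_filter_not Finset.univ (· ∈ S), Finset.sum_eq_zero (s :=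
        Finset.univ.filter fun a => a ∉ S), add_zero]
      · refine Finset.sum_congr (by ext; simp) fun a ha => ?_
        simp only [ha, if_true]
        rw [ih, Finset.card_erase_of_mem ha]
      · intro a ha
        simp only [Finset.mem_filter, Finset.mem_univ, true_and] at ha
        simp [ha, avg]
    rw [h1]
    simp only [Finset.sum_const, nsmul_eq_mul, Finset.card_univ]
    rcases hk : S.card with _ | k
    · simp [hN]
    · rw [succ_descFactorial_eq_add]
      push_cast
      field_simp
      ring

/-- The probability that a uniformly random `F` takes all the values in `S`. -/
noncomputable def coverProb (m : ℕ) (S : Finset α) : ℝ :=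
  avg m fun F => if Covers F S then 1 else 0

lemma coverProb_le [Nonempty α] (m : ℕ) (S : Finset α) :
    coverProb m S ≤ ((m : ℝ) / Fintype.card α) ^ S.card := by
  refine le_trans ?_ ((avg_prod_mult m S).trans_le (descFactorial_div_le m _))
  refine avg_mono fun F => ?_
  split_ifs with h
  · exact_mod_cast Finset.one_le_prod' (one_le_prod_mult h)
  · positivity

lemma coverProb_succ (m : ℕ) (S : Finset α) :
    coverProb (m + 1) S = (∑ a ∈ S, coverProb m (S.erase a)
      + ((Fintype.card α : ℝ) - S.card) * coverProb m S) / (Fintype.card α : ℝ) := by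
  unfold coverProb
  rw [avg_succ]
  simp only [covers_cons]
  congr 1
  rw [← Finset.sum_filter_add_sum_filter_not Finset.univ (· ∈ S)]
  congr 1
  · exact Finset.sum_congr (by ext; simp) fun _ _ => rfl
  · rw [Finset.sum_congr rfl (g := fun _ => avg m fun F => if Covers F S then (1 : ℝ) else 0)]
    · rw [Finset.sum_const, nsmul_eq_mul]
      congr 1
      rw [show (Finset.univ.filter fun a => a ∉ S) = Sᶜ by ext; simp, Finset.card_compl,
        Nat.cast_sub (Finset.card_le_univ S)]
    · intro a ha
      rw [Finset.erase_eq_of_notMem (by simpa using ha)]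

lemma coverProb_nonneg (m : ℕ) (S : Finset α) : 0 ≤ coverProb m S := by
  unfold coverProb avg
  positivity

/-- The first factor is the expected number of ways to cover `S`. The correction pays for sequences
that hit `S` superfluously: each of the `m` positions lands in `S` with probability `S.card / N`. -/
lemma le_coverProb [Nonempty α] (m : ℕ) (S : Finset α) :
    (m.descFactorial S.card : ℝ) / (Fintype.card α : ℝ) ^ S.card *
      (1 - S.card * m / Fintype.card α) ≤ coverProb m S := by
  have hN : (0 : ℝ) < Fintype.card α := by exact_mod_cast Fintype.card_pos
  induction m generalizing S with
  | zero =>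
    rcases S.eq_empty_or_nonempty with rfl | h
    · simp [coverProb, avg, Covers]
    · obtain ⟨k, hk⟩ := Nat.exists_eq_succ_of_ne_zero h.card_pos.ne'
      simp [hk, coverProb_nonneg]
  | succ m ih =>
    rw [coverProb_succ, le_div_iff₀ hN]
    have hS : (S.card : ℝ) ≤ Fintype.card α := by exact_mod_cast Finset.card_le_univ S
    have h2 := mul_le_mul_of_nonneg_left (ih S) (sub_nonneg.2 hS)
    have h1 : ∑ a ∈ S, (m.descFactorial (S.card - 1) : ℝ) /
        (Fintype.card α : ℝ) ^ (S.card - 1) * (1 - (S.card - 1 : ℕ) * m / Fintype.card α) ≤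
        ∑ a ∈ S, coverProb m (S.erase a) := by
      refine Finset.sum_le_sum fun a ha => ?_
      have := ih (S.erase a)
      rwa [Finset.card_erase_of_mem ha] at this
    refine le_trans ?_ (add_le_add h1 h2)
    simp only [Finset.sum_const, nsmul_eq_mul]
    rcases hk : S.card with _ | k
    · simp
    · rw [succ_descFactorial_eq_add]
      rw [hk] at hS
      push_cast at hS ⊢
      set N : ℝ := (Fintype.card α : ℝ)
      set A : ℝ := (m.descFactorial (k + 1) : ℝ)
      set B : ℝ := (m.descFactorial k : ℝ)
      have hA : 0 ≤ A := by positivity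
      have hB : 0 ≤ B := by positivity
      have e1 : (A + (k + 1) * B) / N ^ (k + 1) * (1 - (k + 1) * (m + 1) / N) * N =
          (A * (N - (k + 1) * (m + 1)) * N + (k + 1) * B * (N - (k + 1) * (m + 1)) * N)
            / N ^ (k + 2) := by
        field_simp
        ring
      have e2 : (k + 1) * (B / N ^ k * (1 - k * m / N)) +
          (N - (k + 1)) * (A / N ^ (k + 1) * (1 - (k + 1) * m / N)) =
          ((k + 1) * B * (N - k * m) * N + A * ((N - (k + 1)) * (N - (k + 1) * m)))
            / N ^ (k + 2) := by
        field_simp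
        ring
      rw [e1, e2]
      gcongr ?_ / _
      have e3 : A * (N - (k + 1) * (m + 1)) * N ≤ A * ((N - (k + 1)) * (N - (k + 1) * m)) := by
        rw [mul_assoc]
        refine mul_le_mul_of_nonneg_left ?_ hA
        have : (0 : ℝ) ≤ (k + 1) * ((k + 1) * m) := by positivity
        linarith
      have e4 : (k + 1) * B * (N - (k + 1) * (m + 1)) * N ≤ (k + 1) * B * (N - k * m) * N := by
        gcongr <;> linarith
      linarith

end Counting

/-! ### Implication walks and bicycles. -/

section Walks

variable {n : ℕ}

/-- The complementary literal. -/
def neg (a : Literal n) : Literal n := (a.1, !a.2)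

@[simp] lemma neg_fst (a : Literal n) : (neg a).1 = a.1 := rfl

@[simp] lemma neg_snd (a : Literal n) : (neg a).2 = !a.2 := rfl

@[simp] lemma neg_neg (a : Literal n) : neg (neg a) = a := by simp [neg]

lemma neg_ne (a : Literal n) : neg a ≠ a := by
  intro h
  have := congrArg Prod.snd h
  simp at this

lemma neg_injective : Function.Injective (neg : Literal n → Literal n) := fun a b h => by
  rw [← neg_neg a, h, neg_neg]

lemma eq_or_eq_neg {a b : Literal n} (h : a.1 = b.1) : a = b ∨ a = neg b := by
  obtain ⟨v, p⟩ := a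
  obtain ⟨w, q⟩ := b
  simp only at h
  subst h
  cases p <;> cases q <;> simp [neg]

/-- The clause expressing the implication `a → b`. -/
def arc (a b : Literal n) (h : a.1 ≠ b.1) : Clause n :=
  ⟨{neg a, b}, by
    refine ⟨Finset.card_pair fun e => h (by rw [← e]; rfl), ?_⟩
    rw [Finset.image_insert, Finset.image_singleton]
    exact Finset.card_pair h⟩

lemma fst_ne_of_eq {C : Clause n} {a b : Literal n} (h : C.1 = {neg a, b}) : a.1 ≠ b.1 := by
  intro e
  have := C.2.2
  rw [h, Finset.image_insert, Finset.image_singleton, neg_fst, e] at this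
  simp at this

/-- The clauses expressing the implications `y 0 → y 1 → ⋯ → y (s + 1)`. -/
def walkClauses (y : ℕ → Literal n) (s : ℕ) : Finset (Clause n) :=
  Finset.univ.filter fun C => ∃ t : Fin (s + 1), C.1 = {neg (y t), y (t + 1)}

lemma mem_walkClauses {y : ℕ → Literal n} {s : ℕ} {C : Clause n} :
    C ∈ walkClauses y s ↔ ∃ t ≤ s, C.1 = {neg (y t), y (t + 1)} := by
  simp only [walkClauses, Finset.mem_filter, Finset.mem_univ, true_and]
  exact ⟨fun ⟨t, h⟩ => ⟨t, Nat.lt_succ_iff.1 t.2, h⟩, fun ⟨t, ht, h⟩ => ⟨⟨t, by omega⟩, h⟩⟩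

lemma walkClauses_congr {y z : ℕ → Literal n} {s : ℕ} (h : ∀ t ≤ s + 1, y t = z t) :
    walkClauses y s = walkClauses z s := by
  ext C
  rw [mem_walkClauses, mem_walkClauses]
  refine exists_congr fun t => and_congr_right fun ht => ?_
  rw [h t (by omega), h (t + 1) (by omega)]

/-- The literals `y 1, …, y s` lie on distinct variables. -/
def DistinctVars (y : ℕ → Literal n) (s : ℕ) : Prop :=
  ∀ t r, 1 ≤ t → t ≤ s → 1 ≤ r → r ≤ s → (y t).1 = (y r).1 → t = r

/-- A bicycle: a walk through `s` literals on distinct variables, both ends of which return to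
variables of the walk, and which is not a closed directed cycle. -/
structure IsBicycle (y : ℕ → Literal n) (s : ℕ) : Prop where
  inj : DistinctVars y s
  start : ∃ i, 1 ≤ i ∧ i ≤ s ∧ (y 0).1 = (y i).1
  finish : ∃ j, 1 ≤ j ∧ j ≤ s ∧ (y (s + 1)).1 = (y j).1
  start_ne : (y 0).1 ≠ (y 1).1
  finish_ne : (y s).1 ≠ (y (s + 1)).1
  not_cycle : ¬(y 0 = y s ∧ y (s + 1) = y 1)

namespace IsBicycle

variable {y : ℕ → Literal n} {s : ℕ}

lemma fst_ne (h : IsBicycle y s) {t : ℕ} (ht : t ≤ s) : (y t).1 ≠ (y (t + 1)).1 := by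
  rcases Nat.eq_zero_or_pos t with rfl | h0
  · exact h.start_ne
  · rcases ht.lt_or_eq with h1 | rfl
    · intro e
      have := h.inj t (t + 1) h0 ht (by omega) h1 e
      omega
    · exact h.finish_ne

/-- Two equal clauses cannot be matched crosswise: `y (t + 1) = neg (y r)` would force `t + 1 = r`
and a literal equal to its complement. Matched straight, distinctness of the inner variables leaves
only `t = 0`, `r = s`, which is the closed cycle excluded by `not_cycle`. -/
lemma clause_inj (h : IsBicycle y s) {t r : ℕ} (htr : t < r) (hr : r ≤ s) :
    ({neg (y t), y (t + 1)} : Finset (Literal n)) ≠ {neg (y r), y (r + 1)} := by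
  intro e
  have h1 : y (t + 1) ≠ neg (y r) := by
    intro e1
    have := h.inj (t + 1) r (by omega) (by omega) (by omega) hr (by rw [e1]; rfl)
    subst this
    exact neg_ne _ e1.symm
  have h2 : y (t + 1) = y (r + 1) := by
    have : y (t + 1) ∈ ({neg (y r), y (r + 1)} : Finset (Literal n)) := by rw [← e]; simp
    simpa [h1] using this
  have h3 : y r = y t := by
    have : neg (y r) ∈ ({neg (y t), y (t + 1)} : Finset (Literal n)) := by rw [e]; simp
    rw [Finset.mem_insert, Finset.mem_singleton] at this
    exact neg_injective (this.resolve_right h1.symm)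
  rcases Nat.eq_zero_or_pos t with rfl | h0
  · rcases hr.lt_or_eq with hr | rfl
    · have := h.inj 1 (r + 1) le_rfl (by omega) (by omega) hr (by rw [← h2])
      omega
    · exact h.not_cycle ⟨h3.symm, h2.symm⟩
  · have := h.inj r t (by omega) hr h0 (by omega) (by rw [h3])
    omega

lemma card_walkClauses (h : IsBicycle y s) : (walkClauses y s).card = s + 1 := by
  rw [← Finset.card_range (s + 1)]
  refine (Finset.card_bij (fun t ht => arc (y t) (y (t + 1))
    (h.fst_ne (Nat.lt_succ_iff.1 (Finset.mem_range.1 ht)))) ?_ ?_ ?_).symm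
  · intro t ht
    exact mem_walkClauses.2 ⟨t, Nat.lt_succ_iff.1 (Finset.mem_range.1 ht), rfl⟩
  · intro t ht r hr e
    rw [Finset.mem_range, Nat.lt_succ_iff] at ht hr
    have e' := congrArg Subtype.val e
    rcases lt_trichotomy t r with hl | hl | hl
    · exact absurd e' (h.clause_inj hl hr)
    · exact hl
    · exact absurd e'.symm (h.clause_inj hl ht)
  · intro C hC
    obtain ⟨t, ht, e⟩ := mem_walkClauses.1 hC
    exact ⟨t, Finset.mem_range.2 (by omega), Subtype.ext e.symm⟩

lemma le_card (h : IsBicycle y s) : s ≤ n := by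
  have := Finset.card_le_card_of_injOn (s := Finset.Icc 1 s) (t := (Finset.univ : Finset (Fin n)))
    (fun t => (y t).1) (by simp) (by
      intro t ht r hr e
      simp only [Finset.coe_Icc, Set.mem_Icc] at ht hr
      exact h.inj t r ht.1 ht.2 hr.1 hr.2 e)
  simpa using this

end IsBicycle

/-- The set of variables that occur in the clauses in `S`. -/
def vars (S : Finset (Clause n)) : Finset (Fin n) :=
  S.biUnion fun C => C.1.image Prod.fst

lemma mem_vars {S : Finset (Clause n)} {v : Fin n} :
    v ∈ vars S ↔ ∃ C ∈ S, ∃ l ∈ C.1, l.1 = v := by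
  simp only [vars, Finset.mem_biUnion, Finset.mem_image]

lemma vars_mono {S T : Finset (Clause n)} (h : S ⊆ T) : vars S ⊆ vars T :=
  Finset.biUnion_subset_biUnion_of_subset_left _ h

namespace IsBicycle

variable {y : ℕ → Literal n} {s : ℕ}

lemma exists_index (h : IsBicycle y s) {t : ℕ} (ht : t ≤ s + 1) :
    ∃ r, 1 ≤ r ∧ r ≤ s ∧ (y t).1 = (y r).1 := by
  rcases Nat.eq_zero_or_pos t with rfl | h0
  · exact h.start
  · rcases ht.lt_or_eq with h1 | rfl
    · exact ⟨t, h0, by omega, rfl⟩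
    · exact h.finish

lemma card_vars_le (h : IsBicycle y s) : (vars (walkClauses y s)).card ≤ s := by
  have : vars (walkClauses y s) ⊆ (Finset.Icc 1 s).image fun t => (y t).1 := by
    intro v hv
    obtain ⟨C, hC, l, hl, rfl⟩ := mem_vars.1 hv
    obtain ⟨t, ht, e⟩ := mem_walkClauses.1 hC
    have : ∃ t ≤ s + 1, l.1 = (y t).1 := by
      rw [e, Finset.mem_insert, Finset.mem_singleton] at hl
      rcases hl with rfl | rfl
      · exact ⟨t, by omega, rfl⟩
      · exact ⟨t + 1, by omega, rfl⟩
    obtain ⟨t, ht, e⟩ := this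
    obtain ⟨r, h1, h2, e'⟩ := h.exists_index ht
    exact Finset.mem_image.2 ⟨r, Finset.mem_Icc.2 ⟨h1, h2⟩, (e.trans e').symm⟩
  refine (Finset.card_le_card this).trans (Finset.card_image_le.trans ?_)
  simp

/-- A proper subset of the clauses of a bicycle has a system of distinct representative
variables. -/
lemma card_le_card_vars (h : IsBicycle y s) {J : Finset (Clause n)} (hJ : J ⊂ walkClauses y s) :
    J.card ≤ (vars J).card := by
  have hJs := hJ.1
  obtain ⟨C₀, hC₀, hC₀J⟩ := Finset.exists_of_ssubset hJ
  obtain ⟨t₀, ht₀, e₀⟩ := mem_walkClauses.1 hC₀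
  have key : ∀ C : Clause n, ∃ t, C ∈ J → t ≤ s ∧ t ≠ t₀ ∧ C.1 = {neg (y t), y (t + 1)} := by
    intro C
    by_cases hC : C ∈ J
    · obtain ⟨t, ht, e⟩ := mem_walkClauses.1 (hJs hC)
      refine ⟨t, fun _ => ⟨ht, ?_, e⟩⟩
      rintro rfl
      exact hC₀J ((Subtype.ext (e.trans e₀.symm) : C = C₀) ▸ hC)
    · exact ⟨0, fun h => absurd h hC⟩
  choose τ hτ using key
  -- With clause `t₀` missing, clauses before it are represented by their head and clauses after it
  -- by their tail. The indices used lie in `1, …, t₀` and `t₀ + 1, …, s` respectively, so no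
  -- variable is used twice.
  refine Finset.card_le_card_of_injOn
    (fun C => if τ C < t₀ then (y (τ C + 1)).1 else (y (τ C)).1) ?_ ?_
  · intro C hC
    obtain ⟨-, -, e⟩ := hτ C hC
    refine mem_vars.2 ⟨C, hC, ?_⟩
    simp only
    split_ifs
    · exact ⟨y (τ C + 1), by rw [e]; simp, rfl⟩
    · exact ⟨neg (y (τ C)), by rw [e]; simp, rfl⟩
  · intro C hC D hD e
    obtain ⟨c1, c2, c3⟩ := hτ C hC
    obtain ⟨d1, d2, d3⟩ := hτ D hD
    have : τ C = τ D := by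
      simp only at e
      split_ifs at e with p q q
      · have := h.inj _ _ (by omega) (by omega) (by omega) (by omega) e
        omega
      · have := h.inj _ _ (by omega) (by omega) (by omega) (by omega) e
        omega
      · have := h.inj _ _ (by omega) (by omega) (by omega) (by omega) e
        omega
      · exact h.inj _ _ (by omega) (by omega) (by omega) (by omega) e
    exact Subtype.ext (by rw [c3, d3, this])

end IsBicycle

end Walks

/-! ### Bicycle-free clause sets are satisfiable. -/

section Satisfiability

variable {n : ℕ}

/-- `G` contains the clause expressing `a → b`, and `b` lies on a variable in `V`. -/
def Step (G : Finset (Clause n)) (V : Finset (Fin n)) (a b : Literal n) : Prop :=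
  (∃ C ∈ G, C.1 = {neg a, b}) ∧ b.1 ∈ V

/-- A walk `y 1 → ⋯ → y s` through distinct variables in `V`. -/
structure IsPath (G : Finset (Clause n)) (V : Finset (Fin n)) (y : ℕ → Literal n) (s : ℕ) :
    Prop where
  inj : DistinctVars y s
  mem : ∀ t, 1 ≤ t → t ≤ s → (y t).1 ∈ V
  step : ∀ t, 1 ≤ t → t < s → Step G V (y t) (y (t + 1))

variable {G : Finset (Clause n)} {V : Finset (Fin n)}

lemma Step.contrapose {a b : Literal n} (h : Step G V a b) (ha : a.1 ∈ V) :
    Step G V (neg b) (neg a) := by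
  obtain ⟨⟨C, hC, e⟩, -⟩ := h
  exact ⟨⟨C, hC, by rw [e, neg_neg, Finset.pair_comm]⟩, ha⟩

lemma Step.fst_ne {a b : Literal n} (h : Step G V a b) : a.1 ≠ b.1 := by
  obtain ⟨⟨C, hC, e⟩, -⟩ := h
  exact fst_ne_of_eq e

lemma IsPath.le_card {y : ℕ → Literal n} {s : ℕ} (h : IsPath G V y s) : s ≤ n := by
  have := Finset.card_le_card_of_injOn (s := Finset.Icc 1 s) (t := (Finset.univ : Finset (Fin n)))
    (fun t => (y t).1) (by simp) (by
      intro t ht r hr e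
      simp only [Finset.coe_Icc, Set.mem_Icc] at ht hr
      exact h.inj t r ht.1 ht.2 hr.1 hr.2 e)
  simpa using this

lemma exists_longest_path (hV : V.Nonempty) :
    ∃ s, 1 ≤ s ∧ (∃ y, IsPath G V y s) ∧ ∀ z, ¬IsPath G V z (s + 1) := by
  classical
  obtain ⟨v, hv⟩ := hV
  have h1 : ∃ y, IsPath G V y 1 :=
    ⟨fun _ => (v, true), fun t r _ _ _ _ _ => by omega, fun _ _ _ => hv, fun t _ _ => by omega⟩
  have hn : 1 ≤ n := by
    have := v.2
    omega
  refine ⟨Nat.findGreatest (fun s => ∃ y, IsPath G V y s) n,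
    Nat.le_findGreatest hn h1, Nat.findGreatest_spec (P := fun s => ∃ y, IsPath G V y s) hn h1, ?_⟩
  intro z hz
  have := Nat.le_findGreatest (P := fun s => ∃ y, IsPath G V y s) hz.le_card ⟨z, hz⟩
  omega

lemma IsPath.mem_of_step_last {y : ℕ → Literal n} {s : ℕ} (hs : 1 ≤ s) (h : IsPath G V y s)
    (hmax : ∀ z, ¬IsPath G V z (s + 1)) {v : Literal n} (hv : Step G V (y s) v) :
    ∃ j, 1 ≤ j ∧ j ≤ s ∧ v.1 = (y j).1 := by
  by_contra! hne
  let z : ℕ → Literal n := fun t => if t = s + 1 then v else y t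
  have z1 : z (s + 1) = v := by simp [z]
  have z2 : ∀ t, t ≤ s → z t = y t := fun t ht => by
    simp only [z]
    rw [if_neg (by omega)]
  refine hmax z ⟨?_, ?_, ?_⟩
  · intro t r t1 t2 r1 r2 e
    rcases Nat.lt_or_ge s t with ht | ht <;> rcases Nat.lt_or_ge s r with hr | hr
    · omega
    · obtain rfl : t = s + 1 := by omega
      rw [z1, z2 r hr] at e
      exact absurd e (hne r r1 hr)
    · obtain rfl : r = s + 1 := by omega
      rw [z1, z2 t ht] at e
      exact absurd e.symm (hne t t1 ht)
    · rw [z2 t ht, z2 r hr] at e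
      exact h.inj t r t1 ht r1 hr e
  · intro t t1 t2
    rcases Nat.lt_or_ge s t with ht | ht
    · obtain rfl : t = s + 1 := by omega
      rw [z1]
      exact hv.2
    · rw [z2 t ht]
      exact h.mem t t1 ht
  · intro t t1 t2
    rcases Nat.lt_or_ge t s with ht | ht
    · rw [z2 t ht.le, z2 (t + 1) ht]
      exact h.step t t1 ht
    · obtain rfl : t = s := by omega
      rw [z1, z2 t le_rfl]
      exact hv

lemma IsPath.mem_of_step_first {y : ℕ → Literal n} {s : ℕ} (h : IsPath G V y s)
    (hmax : ∀ z, ¬IsPath G V z (s + 1)) {u : Literal n} (hu : Step G V u (y 1)) (huV : u.1 ∈ V) :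
    ∃ j, 1 ≤ j ∧ j ≤ s ∧ u.1 = (y j).1 := by
  by_contra! hne
  let z : ℕ → Literal n := fun t => if t = 1 then u else y (t - 1)
  have z1 : z 1 = u := by simp [z]
  have z2 : ∀ t, 1 ≤ t → z (t + 1) = y t := fun t ht => by
    simp only [z]
    rw [if_neg (by omega), Nat.add_sub_cancel]
  refine hmax z ⟨?_, ?_, ?_⟩
  · intro t r t1 t2 r1 r2 e
    rcases t1.eq_or_lt with rfl | ht <;> rcases r1.eq_or_lt with rfl | hr
    · rfl
    · obtain ⟨r, rfl⟩ : ∃ k, r = k + 1 := ⟨r - 1, by omega⟩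
      rw [z1, z2 r (by omega)] at e
      exact absurd e (hne r (by omega) (by omega))
    · obtain ⟨t, rfl⟩ : ∃ k, t = k + 1 := ⟨t - 1, by omega⟩
      rw [z1, z2 t (by omega)] at e
      exact absurd e.symm (hne t (by omega) (by omega))
    · obtain ⟨r, rfl⟩ : ∃ k, r = k + 1 := ⟨r - 1, by omega⟩
      obtain ⟨t, rfl⟩ : ∃ k, t = k + 1 := ⟨t - 1, by omega⟩
      rw [z2 t (by omega), z2 r (by omega)] at e
      have := h.inj t r (by omega) (by omega) (by omega) (by omega) e
      omega
  · intro t t1 t2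
    rcases t1.eq_or_lt with rfl | ht
    · rw [z1]
      exact huV
    · obtain ⟨t, rfl⟩ : ∃ k, t = k + 1 := ⟨t - 1, by omega⟩
      rw [z2 t (by omega)]
      exact h.mem t (by omega) (by omega)
  · intro t t1 t2
    rcases t1.eq_or_lt with rfl | ht
    · rw [z1, z2 1 le_rfl]
      exact hu
    · obtain ⟨t, rfl⟩ : ∃ k, t = k + 1 := ⟨t - 1, by omega⟩
      rw [z2 t (by omega), z2 (t + 1) (by omega)]
      exact h.step t (by omega) (by omega)

/-- If every literal has a successor and there is no bicycle, a longest path closes up to a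
directed cycle that cannot be left. -/
lemma IsPath.eq_first_of_step {y : ℕ → Literal n} {s : ℕ} (hs : 1 ≤ s) (h : IsPath G V y s)
    (hmax : ∀ z, ¬IsPath G V z (s + 1)) (hG : ∀ z k, IsBicycle z k → ¬walkClauses z k ⊆ G)
    (hout : ∀ l : Literal n, l.1 ∈ V → ∃ v, Step G V l v)
    {v : Literal n} (hv : Step G V (y s) v) : v = y 1 := by
  by_contra hne
  obtain ⟨u', hu'⟩ := hout (neg (y 1)) (h.mem 1 le_rfl hs)
  -- The contrapositive of a successor of `neg (y 1)` is a predecessor of `y 1`. Extending the path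
  -- by it and by `v` gives a bicycle: maximality puts both ends on path variables, and `v ≠ y 1`
  -- rules out the closed cycle.
  have hu : Step G V (neg u') (y 1) := by
    have := hu'.contrapose (h.mem 1 le_rfl hs)
    rwa [neg_neg] at this
  let z : ℕ → Literal n := fun t => if t = 0 then neg u' else if t = s + 1 then v else y t
  have z0 : z 0 = neg u' := rfl
  have z1 : z (s + 1) = v := by simp [z]
  have z2 : ∀ t, 1 ≤ t → t ≤ s → z t = y t := fun t h1 h2 => by
    simp only [z]
    rw [if_neg (by omega), if_neg (by omega)]
  refine hG z s ⟨?_, ?_, ?_, ?_, ?_, ?_⟩ ?_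
  · intro t r t1 t2 r1 r2 e
    rw [z2 t t1 t2, z2 r r1 r2] at e
    exact h.inj t r t1 t2 r1 r2 e
  · obtain ⟨j, j1, j2, e⟩ := h.mem_of_step_first hmax hu hu'.2
    exact ⟨j, j1, j2, by rw [z0, z2 j j1 j2, e]⟩
  · obtain ⟨j, j1, j2, e⟩ := h.mem_of_step_last hs hmax hv
    exact ⟨j, j1, j2, by rw [z1, z2 j j1 j2, e]⟩
  · rw [z0, z2 1 le_rfl hs]
    exact hu.fst_ne
  · rw [z1, z2 s hs le_rfl]
    exact hv.fst_ne
  · rw [z1, z2 1 le_rfl hs]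
    exact fun e => hne e.2
  · intro C hC
    obtain ⟨t, ht, e⟩ := mem_walkClauses.1 hC
    have : ∃ D ∈ G, D.1 = {neg (z t), z (t + 1)} := by
      rcases Nat.eq_zero_or_pos t with rfl | h0
      · rw [z0, z2 1 le_rfl hs]
        exact hu.1
      · rw [z2 t h0 ht]
        rcases ht.lt_or_eq with h1 | rfl
        · rw [z2 (t + 1) (by omega) h1]
          exact (h.step t h0 h1).1
        · rw [z1]
          exact hv.1
    obtain ⟨D, hD, e'⟩ := this
    rwa [Subtype.ext (e.trans e'.symm : C.1 = D.1)]

/-- A literal without successors reaches only itself. If there is none, the end of a longest path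
has `y 1` as its only successor, so everything reachable from it lies on the path, whose variables
are distinct. -/
lemma exists_consistent_literal (hG : ∀ z k, IsBicycle z k → ¬walkClauses z k ⊆ G)
    (hV : V.Nonempty) : ∃ l : Literal n, l.1 ∈ V ∧ ∀ a,
      Relation.ReflTransGen (Step G V) l a → ¬Relation.ReflTransGen (Step G V) l (neg a) := by
  by_cases hout : ∀ l : Literal n, l.1 ∈ V → ∃ v, Step G V l v
  · obtain ⟨s, hs, ⟨y, hy⟩, hmax⟩ := exists_longest_path (G := G) hV
    -- Each step rotates the path: its first literal becomes its last. The rotated path is again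
    -- longest, so `IsPath.eq_first_of_step` applies to it.
    have key : ∀ a, Relation.ReflTransGen (Step G V) (y s) a → ∃ z, IsPath G V z s ∧ z s = a ∧
        ∀ t, 1 ≤ t → t ≤ s → ∃ r, 1 ≤ r ∧ r ≤ s ∧ z t = y r := by
      intro a ha
      induction ha with
      | refl => exact ⟨y, hy, rfl, fun t t1 t2 => ⟨t, t1, t2, rfl⟩⟩
      | @tail b c _ hbc ih =>
        obtain ⟨z, hz, rfl, hzy⟩ := ih
        obtain rfl := hz.eq_first_of_step hs hmax hG hout hbc
        let x : ℕ → Literal n := fun t => if t = s then z 1 else z (t + 1)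
        have x1 : x s = z 1 := by simp [x]
        have x2 : ∀ t, t < s → x t = z (t + 1) := fun t ht => by
          simp only [x]
          rw [if_neg (by omega)]
        refine ⟨x, ⟨?_, ?_, ?_⟩, x1, ?_⟩
        · intro t r t1 t2 r1 r2 e
          rcases t2.lt_or_eq with ht | rfl <;> rcases r2.lt_or_eq with hr | hr
          · rw [x2 t ht, x2 r hr] at e
            have := hz.inj _ _ (by omega) (by omega) (by omega) (by omega) e
            omega
          · subst hr
            rw [x1, x2 t ht] at e
            have := hz.inj _ _ (by omega) (by omega) (by omega) (by omega) e
            omega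
          · rw [x1, x2 r hr] at e
            have := hz.inj _ _ (by omega) (by omega) (by omega) (by omega) e
            omega
          · exact hr.symm
        · intro t t1 t2
          rcases t2.lt_or_eq with ht | rfl
          · rw [x2 t ht]
            exact hz.mem _ (by omega) (by omega)
          · rw [x1]
            exact hz.mem _ (by omega) (by omega)
        · intro t t1 t2
          rw [x2 t t2]
          rcases Nat.lt_or_ge (t + 1) s with ht | ht
          · rw [x2 _ ht]
            exact hz.step _ (by omega) ht
          · obtain rfl : t + 1 = s := by omega
            rw [x1]
            exact hbc
        · intro t t1 t2
          rcases t2.lt_or_eq with ht | rfl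
          · rw [x2 t ht]
            exact hzy _ (by omega) (by omega)
          · rw [x1]
            exact hzy _ (by omega) (by omega)
    have key' : ∀ a, Relation.ReflTransGen (Step G V) (y s) a → ∃ r, 1 ≤ r ∧ r ≤ s ∧ a = y r := by
      intro a ha
      obtain ⟨z, -, rfl, h⟩ := key a ha
      exact h s hs le_rfl
    refine ⟨y s, hy.mem s hs le_rfl, fun a h1 h2 => ?_⟩
    obtain ⟨t, t1, t2, e⟩ := key' a h1
    obtain ⟨r, r1, r2, e'⟩ := key' _ h2
    have := hy.inj t r t1 t2 r1 r2 (by rw [← e, ← e', neg_fst])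
    subst this
    exact neg_ne a (e'.trans e.symm)
  · push Not at hout
    obtain ⟨l, hl, hno⟩ := hout
    have key : ∀ a, Relation.ReflTransGen (Step G V) l a → a = l := by
      intro a ha
      rcases Relation.ReflTransGen.cases_head ha with h | ⟨c, hc, -⟩
      · exact h.symm
      · exact absurd hc (hno c)
    refine ⟨l, hl, fun a h1 h2 => ?_⟩
    have e1 := key a h1
    have e2 := key _ h2
    subst e1
    exact neg_ne _ e2

/-- A set of clauses without a bicycle is satisfiable. -/
theorem exists_satisfies_of_no_bicycle
    (hG : ∀ z k, IsBicycle z k → ¬walkClauses z k ⊆ G) :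
    ∃ X : Fin n → Bool, ∀ C ∈ G, Satisfies X C := by
  classical
  -- Induction on the set of variables still unassigned; only clauses lying entirely inside it
  -- matter.
  suffices H : ∀ V : Finset (Fin n), ∃ X : Fin n → Bool, ∀ C ∈ G,
      (∀ l ∈ C.1, l.1 ∈ V) → Satisfies X C by
    obtain ⟨X, hX⟩ := H Finset.univ
    exact ⟨X, fun C hC => hX C hC fun _ _ => Finset.mem_univ _⟩
  intro V
  induction V using Finset.strongInduction with
  | H V ih =>
  rcases V.eq_empty_or_nonempty with rfl | hV
  · refine ⟨fun _ => true, fun C _ h => ?_⟩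
    obtain ⟨l, hl⟩ := Finset.card_pos.1 (by rw [C.2.1]; norm_num : 0 < C.1.card)
    simpa using h l hl
  obtain ⟨l, hl, hcons⟩ := exists_consistent_literal hG hV
  set R := Relation.ReflTransGen (Step G V) l with hR
  -- All literals reachable from `l` are made true. A clause touching a reached variable is then
  -- satisfied: if it contains the complement of a reached literal, its other literal is reached.
  -- The remaining clauses live on `W`, which is smaller because it misses `l.1`.
  let W := V.filter fun v => ∀ b, ¬R (v, b)
  obtain ⟨X, hX⟩ := ih W (Finset.filter_ssubset.2 ⟨l.1, hl, fun h => h l.2 .refl⟩)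
  let Y : Fin n → Bool := fun v => if R (v, true) then true else if R (v, false) then false else X v
  have hY1 : ∀ a : Literal n, R a → Y a.1 = a.2 := by
    rintro ⟨v, b⟩ ha
    have := hcons _ ha
    cases b
    · have h' : ¬R (v, true) := this
      simp [Y, h', ha]
    · simp [Y, ha]
  have hY2 : ∀ a : Literal n, (∀ b, ¬R (a.1, b)) → Y a.1 = X a.1 := by
    intro a ha
    simp [Y, ha]
  refine ⟨Y, fun C hC hCV => ?_⟩
  by_cases h1 : ∃ a ∈ C.1, R a
  · obtain ⟨a, ha, hRa⟩ := h1
    exact ⟨a, ha, hY1 a hRa⟩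
  push Not at h1
  have h2 : ∀ a ∈ C.1, ∀ b, ¬R (a.1, b) := by
    intro a ha b hb
    rcases eq_or_eq_neg (show ((a.1, b) : Literal n).1 = a.1 from rfl) with e | e
    · rw [e] at hb
      exact h1 a ha hb
    · rw [e] at hb
      obtain ⟨c, d, hcd, e'⟩ := Finset.card_eq_two.1 C.2.1
      have : ∃ d ∈ C.1, C.1 = {a, d} := by
        rw [e'] at ha ⊢
        rcases Finset.mem_insert.1 ha with rfl | ha
        · exact ⟨d, by simp, rfl⟩
        · rw [Finset.mem_singleton] at ha
          subst ha
          exact ⟨c, by simp, Finset.pair_comm _ _⟩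
      obtain ⟨d, hd, e'⟩ := this
      exact h1 d hd (hb.tail ⟨⟨C, hC, by rw [e', neg_neg]⟩, hCV d hd⟩)
  obtain ⟨a, ha, e⟩ := hX C hC fun a ha => Finset.mem_filter.2 ⟨hCV a ha, h2 a ha⟩
  exact ⟨a, ha, by rw [hY2 a (h2 a ha), e]⟩

end Satisfiability

/-! ### The upper bound: counting bicycles. -/

section UpperBound

variable {n : ℕ}

/-- Of all pairs of literals, exactly the `n` complementary pairs are not clauses. -/
lemma card_clause (n : ℕ) : Fintype.card (Clause n) = 2 * n * (n - 1) := by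
  classical
  have h0 : Fintype.card (Clause n) = ((Finset.powersetCard 2 (Finset.univ : Finset (Literal n))).filter
      fun C => (C.image Prod.fst).card = 2).card := by
    rw [Fintype.card_subtype]
    congr 1
    ext C
    simp [Finset.mem_powersetCard]
  have h1 : ((Finset.powersetCard 2 (Finset.univ : Finset (Literal n))).filter
      fun C => ¬(C.image Prod.fst).card = 2) =
      (Finset.univ : Finset (Fin n)).image fun v => {(v, true), (v, false)} := by
    ext C
    simp only [Finset.mem_filter, Finset.mem_powersetCard, Finset.subset_univ, true_and,
      Finset.mem_image, Finset.mem_univ]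
    constructor
    · rintro ⟨h, h'⟩
      obtain ⟨a, b, hab, rfl⟩ := Finset.card_eq_two.1 h
      have e : a.1 = b.1 := by
        by_contra e
        refine h' ?_
        rw [Finset.image_insert, Finset.image_singleton]
        exact Finset.card_pair e
      obtain ⟨v, p⟩ := a
      obtain ⟨w, q⟩ := b
      simp only at e
      subst e
      refine ⟨v, ?_⟩
      cases p <;> cases q <;> simp_all [Finset.pair_comm]
    · rintro ⟨v, rfl⟩
      refine ⟨Finset.card_pair (by simp), ?_⟩
      rw [Finset.image_insert, Finset.image_singleton]
      simp
  have h2 := Finset.card_filter_add_card_filter_not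
    (s := Finset.powersetCard 2 (Finset.univ : Finset (Literal n)))
    (fun C => (C.image Prod.fst).card = 2)
  rw [h1, ← h0, Finset.card_image_of_injective, Finset.card_powersetCard, Finset.card_univ,
    Finset.card_univ, Fintype.card_prod, Fintype.card_fin, Fintype.card_bool,
    Nat.choose_two_right] at h2
  · rcases n with _ | p
    · simpa using h2
    · have : (p + 1) * 2 * ((p + 1) * 2 - 1) / 2 = (p + 1) * (2 * p + 1) := by
        rw [show (p + 1) * 2 * ((p + 1) * 2 - 1) = (p + 1) * (2 * p + 1) * 2 by
          rw [show (p + 1) * 2 - 1 = 2 * p + 1 by omega]; ring]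
        simp
      rw [this] at h2
      rw [Nat.add_sub_cancel]
      nlinarith
  · intro v w h
    have : (v, true) ∈ ({(w, true), (w, false)} : Finset (Literal n)) := by
      have h : ({(v, true), (v, false)} : Finset (Literal n)) = {(w, true), (w, false)} := h
      rw [← h]
      simp
    simpa using this

lemma nonempty_clause (hn : 2 ≤ n) : Nonempty (Clause n) := by
  rw [← Fintype.card_pos_iff, card_clause]
  have : 0 < n - 1 := by omega
  positivity

lemma card_sub_f_eq_avg (hn : 2 ≤ n) (m : ℕ) :
    (m : ℝ) - f n m = avg m fun F : Formula n m => (m : ℝ) - maxSat F := by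
  have := nonempty_clause hn
  rw [avg_sub]
  have h : Fintype.card (Formula n m) = Fintype.card (Clause n) ^ m := by
    rw [Fintype.card_fun, Fintype.card_fin]
  have h1 : avg m (fun _ : Formula n m => (m : ℝ)) = m := by
    rw [avg, Finset.sum_const, Finset.card_univ, h, nsmul_eq_mul]
    push_cast
    field_simp
  rw [h1, f, avg, h]
  push_cast
  rfl

open Classical in
/-- The clause sets of the bicycles through `s` literals. -/
noncomputable def bicycles (n s : ℕ) : Finset (Finset (Clause n)) :=
  Finset.univ.filter fun S => ∃ y, IsBicycle y s ∧ S = walkClauses y s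

lemma mem_bicycles {s : ℕ} {S : Finset (Clause n)} :
    S ∈ bicycles n s ↔ ∃ y, IsBicycle y s ∧ S = walkClauses y s := by
  simp [bicycles]

/-- The walk with inner literals on the variables `e` with signs `σ`, and given ends. -/
def walkOf {s : ℕ} (e : Fin s → Fin n) (σ : Fin s → Bool) (a b : Literal n) (t : ℕ) : Literal n :=
  if t = 0 then a else if h : t - 1 < s then (e ⟨t - 1, h⟩, σ ⟨t - 1, h⟩) else b

@[simp] lemma walkOf_zero {s : ℕ} (e : Fin s → Fin n) (σ : Fin s → Bool) (a b : Literal n) :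
    walkOf e σ a b 0 = a := rfl

lemma walkOf_succ {s : ℕ} (e : Fin s → Fin n) (σ : Fin s → Bool) (a b : Literal n) (t : Fin s) :
    walkOf e σ a b (t + 1) = (e t, σ t) := by
  simp [walkOf]

@[simp] lemma walkOf_last {s : ℕ} (e : Fin s → Fin n) (σ : Fin s → Bool) (a b : Literal n) :
    walkOf e σ a b (s + 1) = b := by
  simp [walkOf]

/-- The factors count the ordered inner variables, their signs, and the two ends, each of which is
one of the `2 * s` literals on inner variables. -/
lemma card_bicycles_le (n s : ℕ) :
    (bicycles n s).card ≤ n.descFactorial s * 2 ^ s * (2 * s) ^ 2 := by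
  classical
  have : bicycles n s ⊆ (Finset.univ : Finset ((Fin s ↪ Fin n) × (Fin s → Bool) ×
      (Fin s × Bool) × (Fin s × Bool))).image fun p =>
      walkClauses (walkOf p.1 p.2.1 (p.1 p.2.2.1.1, p.2.2.1.2) (p.1 p.2.2.2.1, p.2.2.2.2)) s := by
    intro S hS
    obtain ⟨y, hy, rfl⟩ := mem_bicycles.1 hS
    obtain ⟨i, i2, hi⟩ : ∃ i, i < s ∧ (y 0).1 = (y (i + 1)).1 := by
      obtain ⟨i, i1, i2, hi⟩ := hy.start
      exact ⟨i - 1, by omega, by rwa [Nat.sub_add_cancel i1]⟩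
    obtain ⟨j, j2, hj⟩ : ∃ j, j < s ∧ (y (s + 1)).1 = (y (j + 1)).1 := by
      obtain ⟨j, j1, j2, hj⟩ := hy.finish
      exact ⟨j - 1, by omega, by rwa [Nat.sub_add_cancel j1]⟩
    let e : Fin s ↪ Fin n := ⟨fun t => (y (t + 1)).1, fun t r h => Fin.ext (by
      have := hy.inj (t + 1) (r + 1) (by omega) (by omega) (by omega) (by omega) h
      omega)⟩
    refine Finset.mem_image.2 ⟨(e, fun t => (y (t + 1)).2, (⟨i, i2⟩, (y 0).2),
      (⟨j, j2⟩, (y (s + 1)).2)), Finset.mem_univ _, walkClauses_congr ?_⟩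
    intro t ht
    rcases Nat.eq_zero_or_pos t with rfl | h0
    · exact (Prod.ext hi.symm rfl)
    · rcases ht.lt_or_eq with h1 | rfl
      · obtain ⟨r, rfl⟩ : ∃ r, t = r + 1 := ⟨t - 1, by omega⟩
        exact walkOf_succ _ _ _ _ ⟨r, by omega⟩
      · simp only [walkOf_last]
        exact Prod.ext hj.symm rfl
  refine (Finset.card_le_card this).trans (Finset.card_image_le.trans (le_of_eq ?_))
  simp only [Finset.card_univ, Fintype.card_prod, Fintype.card_embedding_eq, Fintype.card_fun,
    Fintype.card_fin, Fintype.card_bool]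
  ring

lemma numSat_add {m : ℕ} (F : Formula n m) (X : Fin n → Bool) :
    numSat F X + (Finset.univ.filter fun i => ¬Satisfies X (F i)).card = m := by
  have := Finset.card_filter_add_card_filter_not (s := (Finset.univ : Finset (Fin m)))
    (fun i => Satisfies X (F i))
  simpa [numSat] using this

lemma numSat_le_maxSat {m : ℕ} (F : Formula n m) (X : Fin n → Bool) : numSat F X ≤ maxSat F :=
  Finset.le_sup (f := fun X => numSat F X) (Finset.mem_univ X)

/-- Choose a clause `g S` in every bicycle `S`. The clauses of `F` other than the `g S` of covered
bicycles contain no bicycle, so some assignment satisfies them all. It violates only occurrences of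
such `g S`, and `mult F (g S)` is at most the product over `S`, whose other factors are at least 1.
-/
lemma sub_maxSat_le (hn : 2 ≤ n) {m : ℕ} (F : Formula n m) :
    (m : ℝ) - maxSat F ≤
      ∑ s ∈ Finset.range (n + 1), ∑ S ∈ bicycles n s, ∏ C ∈ S, (mult F C : ℝ) := by
  classical
  have hne : ∀ S : Finset (Clause n), ∃ C, S.Nonempty → C ∈ S := by
    intro S
    rcases S.eq_empty_or_nonempty with rfl | ⟨C, hC⟩
    · exact ⟨(nonempty_clause hn).some, fun h => absurd h Finset.not_nonempty_empty⟩
    · exact ⟨C, fun _ => hC⟩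
  choose g hg using hne
  have hgB : ∀ s, ∀ S ∈ bicycles n s, g S ∈ S := by
    intro s S hS
    obtain ⟨y, hy, rfl⟩ := mem_bicycles.1 hS
    exact hg _ (Finset.card_pos.1 (by rw [hy.card_walkClauses]; omega))
  let G : Finset (Clause n) := Finset.univ.filter fun C => (∃ i, F i = C) ∧
    ∀ s ∈ Finset.range (n + 1), ∀ S ∈ bicycles n s, Covers F S → C ≠ g S
  have hG : ∀ C, C ∈ G ↔ (∃ i, F i = C) ∧
      ∀ s ∈ Finset.range (n + 1), ∀ S ∈ bicycles n s, Covers F S → C ≠ g S := by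
    intro C
    simp only [G, Finset.mem_filter, Finset.mem_univ, true_and]
  obtain ⟨X, hX⟩ : ∃ X : Fin n → Bool, ∀ C ∈ G, Satisfies X C := by
    refine exists_satisfies_of_no_bicycle fun z k hz hzG => ?_
    have hB : walkClauses z k ∈ bicycles n k := mem_bicycles.2 ⟨z, hz, rfl⟩
    have h1 := ((hG _).1 (hzG (hgB _ _ hB))).2 k
      (Finset.mem_range.2 (Nat.lt_succ_iff.2 hz.le_card)) _ hB
    exact h1 (fun C hC => ((hG _).1 (hzG hC)).1) rfl
  have h1 : (Finset.univ.filter fun i => ¬Satisfies X (F i)) ⊆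
      (Finset.range (n + 1)).biUnion fun s => (bicycles n s).biUnion fun S =>
        if Covers F S then Finset.univ.filter fun i => F i = g S else ∅ := by
    intro i hi
    have hiG : F i ∉ G := fun h => (Finset.mem_filter.1 hi).2 (hX _ h)
    simp only [hG, not_and, not_forall] at hiG
    obtain ⟨s, hs, S, hS, hc, e⟩ := hiG ⟨i, rfl⟩
    rw [not_not] at e
    refine Finset.mem_biUnion.2 ⟨s, hs, Finset.mem_biUnion.2 ⟨S, hS, ?_⟩⟩
    rw [if_pos hc]
    simp [e]
  have h2 : (Finset.univ.filter fun i => ¬Satisfies X (F i)).card ≤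
      ∑ s ∈ Finset.range (n + 1), ∑ S ∈ bicycles n s, ∏ C ∈ S, mult F C := by
    refine (Finset.card_le_card h1).trans (Finset.card_biUnion_le.trans
      (Finset.sum_le_sum fun s _ => Finset.card_biUnion_le.trans
        (Finset.sum_le_sum fun S hS => ?_)))
    split_ifs with hc
    · exact Nat.le_of_dvd (Finset.prod_pos fun C hC => one_le_prod_mult hc C hC)
        (Finset.dvd_prod_of_mem (fun C => mult F C) (hgB s S hS))
    · simp
  have h3 : (m : ℝ) ≤ maxSat F + (Finset.univ.filter fun i => ¬Satisfies X (F i)).card := by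
    have := numSat_add F X
    have := numSat_le_maxSat F X
    exact_mod_cast (by omega : m ≤ maxSat F + _)
  have h4 : ((Finset.univ.filter fun i => ¬Satisfies X (F i)).card : ℝ) ≤
      ∑ s ∈ Finset.range (n + 1), ∑ S ∈ bicycles n s, ∏ C ∈ S, (mult F C : ℝ) := by
    exact_mod_cast h2
  linarith

/-- The quadratic factor from the two ends is bounded by a binomial coefficient so that the sum over
`k` becomes the series of `1 / (1 - c) ^ 3`. -/
lemma expected_bicycles_le (hn : 2 ≤ n) {m : ℕ} {c : ℝ} (hm : (m : ℝ) ≤ c * n)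
    (hc : c ≤ 1) (k : ℕ) :
    ((bicycles n (k + 1)).card : ℝ) * ((m : ℝ) / Fintype.card (Clause n)) ^ (k + 2) ≤
      16 / n * (((k + 2).choose 2 : ℕ) * c ^ k) := by
  obtain ⟨p, rfl⟩ : ∃ p, n = p + 1 := ⟨n - 1, by omega⟩
  have hp : (1 : ℝ) ≤ p := by exact_mod_cast (by omega : 1 ≤ p)
  have hcard : (Fintype.card (Clause (p + 1)) : ℝ) = 2 * (p + 1) * p := by
    rw [card_clause]
    push_cast
    simp
  have hB : ((bicycles (p + 1) (k + 1)).card : ℝ) ≤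
      (p + 1) * p ^ k * 2 ^ (k + 1) * (2 * (k + 1)) ^ 2 := by
    have h1 := card_bicycles_le (p + 1) (k + 1)
    rw [Nat.succ_descFactorial_succ] at h1
    have h2 : (p + 1) * p.descFactorial k * 2 ^ (k + 1) * (2 * (k + 1)) ^ 2 ≤
        (p + 1) * p ^ k * 2 ^ (k + 1) * (2 * (k + 1)) ^ 2 := by
      gcongr
      exact Nat.descFactorial_le_pow p k
    exact_mod_cast h1.trans h2
  set x : ℝ := m / (p + 1) with hx
  have hx0 : 0 ≤ x := by positivity
  have hxc : x ≤ c := by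
    rw [hx, div_le_iff₀ (by positivity)]
    exact_mod_cast hm
  have hq : (m : ℝ) / Fintype.card (Clause (p + 1)) = x / (2 * p) := by
    rw [hcard, hx]
    field_simp
  have hch : ((k : ℝ) + 1) ^ 2 ≤ 2 * (((k + 2).choose 2 : ℕ) : ℝ) := by
    rw [Nat.cast_choose_two]
    push_cast
    nlinarith [(Nat.cast_nonneg k : (0 : ℝ) ≤ k)]
  have hxk : x ^ (k + 2) ≤ c ^ k := by
    rw [pow_add]
    calc x ^ k * x ^ 2 ≤ c ^ k * 1 := by
          have hc0 : 0 ≤ c := hx0.trans hxc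
          gcongr
          exact pow_le_one₀ hx0 (hxc.trans hc)
      _ = c ^ k := mul_one _
  have hp2 : ((p : ℝ) + 1) / p ^ 2 ≤ 4 / (p + 1) := by
    rw [div_le_div_iff₀ (by positivity) (by positivity)]
    nlinarith
  rw [hq]
  calc ((bicycles (p + 1) (k + 1)).card : ℝ) * (x / (2 * p)) ^ (k + 2)
      ≤ ((p + 1) * p ^ k * 2 ^ (k + 1) * (2 * (k + 1)) ^ 2) * (x / (2 * p)) ^ (k + 2) := by
        gcongr
    _ = 2 * (((p : ℝ) + 1) / p ^ 2) * (((k : ℝ) + 1) ^ 2 * x ^ (k + 2)) := by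
        rw [div_pow, mul_pow]
        field_simp
        ring
    _ ≤ 2 * (4 / (p + 1)) * (2 * (((k + 2).choose 2 : ℕ) : ℝ) * c ^ k) := by
        gcongr
    _ = 16 / ((p + 1 : ℕ) : ℝ) * (((k + 2).choose 2 : ℕ) * c ^ k) := by
        push_cast
        ring

theorem sub_f_le (hn : 2 ≤ n) {m : ℕ} {ε : ℝ} (h0 : 0 < ε) (h1 : ε ≤ 1)
    (hm : (m : ℝ) ≤ (1 - ε) * n) : (m : ℝ) - f n m ≤ 16 * (1 / (ε ^ 3 * n)) := by
  have := nonempty_clause hn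
  have hsum := hasSum_choose_mul_geometric_of_norm_lt_one (𝕜 := ℝ) 2 (r := 1 - ε)
    (by rw [Real.norm_of_nonneg (by linarith)]; linarith)
  -- The ends must return to an inner variable, so `s = 0` contributes nothing and the sum can be
  -- reindexed by `s = k + 1`.
  have hB0 : bicycles n 0 = ∅ := by
    rw [← Finset.card_eq_zero]
    simpa using card_bicycles_le n 0
  have hterm : ∀ s, avg m (fun F : Formula n m => ∑ S ∈ bicycles n s, ∏ C ∈ S, (mult F C : ℝ)) ≤
      (bicycles n s).card * ((m : ℝ) / Fintype.card (Clause n)) ^ (s + 1) := by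
    intro s
    rw [avg_sum, ← nsmul_eq_mul]
    refine Finset.sum_le_card_nsmul _ _ _ fun S hS => ?_
    obtain ⟨y, hy, rfl⟩ := mem_bicycles.1 hS
    rw [avg_prod_mult, ← hy.card_walkClauses]
    exact descFactorial_div_le _ _
  calc (m : ℝ) - f n m = avg m fun F : Formula n m => (m : ℝ) - maxSat F := card_sub_f_eq_avg hn m
    _ ≤ avg m fun F : Formula n m =>
        ∑ s ∈ Finset.range (n + 1), ∑ S ∈ bicycles n s, ∏ C ∈ S, (mult F C : ℝ) :=
        avg_mono fun F => sub_maxSat_le hn F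
    _ ≤ ∑ s ∈ Finset.range (n + 1), (bicycles n s).card *
        ((m : ℝ) / Fintype.card (Clause n)) ^ (s + 1) := by
        rw [avg_sum]
        exact Finset.sum_le_sum fun s _ => hterm s
    _ ≤ ∑ k ∈ Finset.range n, 16 / n * (((k + 2).choose 2 : ℕ) * (1 - ε) ^ k) := by
        rw [Finset.sum_range_succ', hB0]
        simp only [Finset.card_empty, Nat.cast_zero, zero_mul, add_zero]
        exact Finset.sum_le_sum fun k _ => expected_bicycles_le hn hm (by linarith) k
    _ ≤ 16 / n * (1 / (1 - (1 - ε)) ^ (2 + 1)) := by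
        rw [← Finset.mul_sum]
        gcongr
        exact sum_le_hasSum _ (fun k _ => by
          have : 0 ≤ 1 - ε := by linarith
          positivity) hsum
    _ = 16 * (1 / (ε ^ 3 * n)) := by
        have : (n : ℝ) ≠ 0 := by
          have : n ≠ 0 := by omega
          exact_mod_cast this
        rw [sub_sub_cancel]
        field_simp

end UpperBound

/-! ### Contradictory bicycles and their number. -/

section Contradictory

variable {n : ℕ}

/-- A bicycle whose first clause is `y i ∨ y 1` and whose last clause is `¬ y s ∨ ¬ y j`, with
`i ≤ j`: its clauses are contradictory. The sign conditions make the walk unique, given its set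
of clauses. -/
structure IsContradictory (y : ℕ → Literal n) (s i j : ℕ) : Prop where
  inj : DistinctVars y s
  two_le : 2 ≤ i
  le : i ≤ j
  lt : j < s
  start : y 0 = neg (y i)
  finish : y (s + 1) = neg (y j)
  pos : ∀ t ∈ ({1, i - 1, i, j, j + 1, s} : Finset ℕ), (y t).2 = true

lemma IsBicycle.exists_index_of_mem {y : ℕ → Literal n} {s : ℕ} (h : IsBicycle y s)
    {C : Clause n} (hC : C ∈ walkClauses y s) {l : Literal n} (hl : l ∈ C.1) :
    ∃ r, 1 ≤ r ∧ r ≤ s ∧ l.1 = (y r).1 := by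
  obtain ⟨t, ht, e⟩ := mem_walkClauses.1 hC
  rw [e, Finset.mem_insert, Finset.mem_singleton] at hl
  rcases hl with rfl | rfl
  · exact h.exists_index (by omega : t ≤ s + 1)
  · exact h.exists_index (by omega : t + 1 ≤ s + 1)

lemma pair_right_injective {a b c : Literal n} (h : ({a, b} : Finset (Literal n)) = {a, c}) :
    b = c := by
  have h1 : b ∈ ({a, c} : Finset (Literal n)) := by rw [← h]; simp
  have h2 : c ∈ ({a, b} : Finset (Literal n)) := by rw [h]; simp
  simp only [Finset.mem_insert, Finset.mem_singleton] at h1 h2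
  rcases h1 with rfl | h1
  · rcases h2 with rfl | h2
    · rfl
    · exact h2.symm
  · exact h1

namespace IsContradictory

variable {y z : ℕ → Literal n} {s i j i' j' : ℕ}

lemma isBicycle (h : IsContradictory y s i j) : IsBicycle y s where
  inj := h.inj
  start := ⟨i, by have := h.two_le; omega, by have := h.le; have := h.lt; omega,
    by rw [h.start, neg_fst]⟩
  finish := ⟨j, by have := h.two_le; have := h.le; omega, h.lt.le, by rw [h.finish, neg_fst]⟩
  start_ne := by
    have := h.two_le; have := h.le; have := h.lt
    intro e
    rw [h.start, neg_fst] at e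
    have := h.inj _ _ (by omega) (by omega) (by omega) (by omega) e
    omega
  finish_ne := by
    have := h.two_le; have := h.le; have := h.lt
    intro e
    rw [h.finish, neg_fst] at e
    have := h.inj _ _ (by omega) (by omega) (by omega) (by omega) e
    omega
  not_cycle := by
    have := h.two_le; have := h.le; have := h.lt
    rintro ⟨e, -⟩
    rw [h.start] at e
    have := h.inj i s (by omega) (by omega) (by omega) (by omega) (by rw [← e, neg_fst])
    omega

/-- The walk reads `¬y i → ⋯ → y i → ⋯ → y j → ⋯ → ¬y j`. The first stretch forces `y i`, hence `y
j` because `i ≤ j`, and the last stretch refutes it. -/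
lemma exists_not_satisfies (h : IsContradictory y s i j) (X : Fin n → Bool) :
    ∃ C ∈ walkClauses y s, ¬Satisfies X C := by
  by_contra! hX
  have hstep : ∀ t, t ≤ s → X (y t).1 = (y t).2 → X (y (t + 1)).1 = (y (t + 1)).2 := by
    intro t ht e
    obtain ⟨l, hl, hl'⟩ := hX (arc _ _ (h.isBicycle.fst_ne ht)) (mem_walkClauses.2 ⟨t, ht, rfl⟩)
    rcases Finset.mem_insert.1 hl with rfl | hl
    · rw [neg_fst, neg_snd, e] at hl'
      simp at hl'
    · rw [Finset.mem_singleton] at hl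
      rw [← hl, hl']
  have hreach : ∀ t r, t ≤ r → r ≤ s + 1 → X (y t).1 = (y t).2 → X (y r).1 = (y r).2 := by
    intro t r htr
    induction r, htr using Nat.le_induction with
    | base => exact fun _ e => e
    | succ r _ ih => exact fun hr e => hstep r (by omega) (ih (by omega) e)
  have := h.two_le; have := h.le; have := h.lt
  have hi : X (y i).1 = (y i).2 := by
    by_contra hi
    refine hi (hreach 0 i (by omega) (by omega) ?_)
    rw [h.start, neg_fst, neg_snd]
    revert hi
    cases X (y i).1 <;> cases (y i).2 <;> simp
  have hj := hreach i j (by omega) (by omega) hi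
  have hs := hreach j (s + 1) (by omega) (by omega) hj
  rw [h.finish, neg_fst, neg_snd, hj] at hs
  simp at hs

lemma mem_of_le (h : IsContradictory y s i j) {t : ℕ} (ht : t ≤ s) :
    ∃ C ∈ walkClauses y s, C.1 = {neg (y t), y (t + 1)} :=
  ⟨arc _ _ (h.isBicycle.fst_ne ht), mem_walkClauses.2 ⟨t, ht, rfl⟩, rfl⟩

lemma eq_of_mem_of_neg (h : IsContradictory y s i j) {t : ℕ} (h1 : 1 ≤ t) (h2 : t ≤ s)
    {b : Literal n} {C : Clause n} (hC : C ∈ walkClauses y s) (e : C.1 = {neg (y t), b}) :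
    b = y (t + 1) ∨ t = j ∧ b = neg (y s) := by
  have := h.two_le; have := h.le; have := h.lt
  obtain ⟨r, hr, e'⟩ := mem_walkClauses.1 hC
  rw [e] at e'
  have hm : neg (y t) ∈ ({neg (y r), y (r + 1)} : Finset (Literal n)) := by rw [← e']; simp
  rw [Finset.mem_insert, Finset.mem_singleton] at hm
  rcases hm with hm | hm
  · have hm' := neg_injective hm
    rcases Nat.eq_zero_or_pos r with rfl | h0
    · rw [h.start] at hm'
      have := h.inj t i h1 h2 (by omega) (by omega) (by rw [hm', neg_fst])
      subst this
      exact absurd hm'.symm (neg_ne _)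
    · have := h.inj t r h1 h2 h0 hr (by rw [hm'])
      subst this
      exact .inl (pair_right_injective e')
  · rcases hr.lt_or_eq with hr | rfl
    · have := h.inj t (r + 1) h1 h2 (by omega) hr (by rw [← hm, neg_fst])
      subst this
      exact absurd hm (neg_ne _)
    · rw [h.finish] at hm
      have hm' := neg_injective hm
      have := h.inj t j h1 h2 (by omega) (by omega) (by rw [hm'])
      subst this
      rw [h.finish, Finset.pair_comm (neg (y r))] at e'
      exact .inr ⟨rfl, pair_right_injective e'⟩

lemma eq_of_mem (h : IsContradictory y s i j) {t : ℕ} (h1 : 1 ≤ t) (h2 : t ≤ s)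
    {b : Literal n} {C : Clause n} (hC : C ∈ walkClauses y s) (e : C.1 = {y t, b}) :
    b = neg (y (t - 1)) ∨ t = i ∧ b = y 1 := by
  have := h.two_le; have := h.le; have := h.lt
  obtain ⟨r, hr, e'⟩ := mem_walkClauses.1 hC
  rw [e] at e'
  have hm : y t ∈ ({neg (y r), y (r + 1)} : Finset (Literal n)) := by rw [← e']; simp
  rw [Finset.mem_insert, Finset.mem_singleton] at hm
  rcases hm with hm | hm
  · rcases Nat.eq_zero_or_pos r with rfl | h0
    · rw [h.start, neg_neg] at hm
      have := h.inj t i h1 h2 (by omega) (by omega) (by rw [hm])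
      subst this
      rw [h.start, neg_neg] at e'
      exact .inr ⟨rfl, pair_right_injective e'⟩
    · have := h.inj t r h1 h2 h0 hr (by rw [hm, neg_fst])
      subst this
      exact absurd hm.symm (neg_ne _)
  · rcases hr.lt_or_eq with hr | rfl
    · have := h.inj t (r + 1) h1 h2 (by omega) hr (by rw [hm])
      subst this
      rw [Finset.pair_comm (neg (y r))] at e'
      exact .inl (pair_right_injective e')
    · rw [h.finish] at hm
      have := h.inj t j h1 h2 (by omega) (by omega) (by rw [hm, neg_fst])
      subst this
      exact absurd hm.symm (neg_ne _)

/-- The literal `y i` occurs in two clauses, distinct because `y (i - 1)` and `y 1` are both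
positive. In the walk `z`, only `z i'` and `neg (z j')` can occur twice, and the latter has the
wrong sign. -/
lemma start_eq (h : IsContradictory y s i j) (h' : IsContradictory z s i' j')
    (H : walkClauses y s = walkClauses z s) : y i = z i' := by
  have := h.two_le; have := h.le; have := h.lt
  obtain ⟨C, hC, eC⟩ := h.mem_of_le (t := i - 1) (by omega)
  obtain ⟨D, hD, eD⟩ := h.mem_of_le (t := 0) (by omega)
  rw [Nat.sub_add_cancel (by omega), Finset.pair_comm] at eC
  rw [h.start, neg_neg, zero_add] at eD
  rw [H] at hC hD
  have hne : neg (y (i - 1)) ≠ y 1 := fun e => by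
    have := congrArg Prod.snd e
    rw [neg_snd, h.pos (i - 1) (by simp), h.pos 1 (by simp)] at this
    simp at this
  obtain ⟨r, r1, r2, hr⟩ := h'.isBicycle.exists_index_of_mem hC (l := y i) (by rw [eC]; simp)
  rcases eq_or_eq_neg hr with e | e
  · rw [e] at eC eD
    rcases h'.eq_of_mem r1 r2 hC eC with e1 | ⟨rfl, -⟩
    · rcases h'.eq_of_mem r1 r2 hD eD with e2 | ⟨rfl, -⟩
      · exact absurd (e1.trans e2.symm) hne
      · exact e
    · exact e
  · rw [e] at eC eD
    exfalso
    have key : r = j' := by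
      rcases h'.eq_of_mem_of_neg r1 r2 hC eC with e1 | ⟨rfl, -⟩
      · rcases h'.eq_of_mem_of_neg r1 r2 hD eD with e2 | ⟨rfl, -⟩
        · exact absurd (e1.trans e2.symm) hne
        · rfl
      · rfl
    have := congrArg Prod.snd e
    rw [key, neg_snd, h.pos i (by simp), h'.pos j' (by simp)] at this
    simp at this

lemma finish_eq (h : IsContradictory y s i j) (h' : IsContradictory z s i' j')
    (H : walkClauses y s = walkClauses z s) : y j = z j' := by
  have := h.two_le; have := h.le; have := h.lt
  obtain ⟨C, hC, eC⟩ := h.mem_of_le (t := j) (by omega)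
  obtain ⟨D, hD, eD⟩ := h.mem_of_le (t := s) le_rfl
  rw [h.finish, Finset.pair_comm] at eD
  rw [H] at hC hD
  have hne : y (j + 1) ≠ neg (y s) := fun e => by
    have := congrArg Prod.snd e
    rw [neg_snd, h.pos (j + 1) (by simp), h.pos s (by simp)] at this
    simp at this
  obtain ⟨r, r1, r2, hr⟩ := h'.isBicycle.exists_index_of_mem hC (l := neg (y j))
    (by rw [eC]; simp)
  rw [neg_fst] at hr
  rcases eq_or_eq_neg hr with e | e
  · rw [e] at eC eD
    rcases h'.eq_of_mem_of_neg r1 r2 hC eC with e1 | ⟨rfl, -⟩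
    · rcases h'.eq_of_mem_of_neg r1 r2 hD eD with e2 | ⟨rfl, -⟩
      · exact absurd (e1.trans e2.symm) hne
      · exact e
    · exact e
  · rw [e, neg_neg] at eC eD
    exfalso
    have key : r = i' := by
      rcases h'.eq_of_mem r1 r2 hC eC with e1 | ⟨rfl, -⟩
      · rcases h'.eq_of_mem r1 r2 hD eD with e2 | ⟨rfl, -⟩
        · exact absurd (e1.trans e2.symm) hne
        · rfl
      · rfl
    have := congrArg Prod.snd e
    rw [key, neg_snd, h.pos j (by simp), h'.pos i' (by simp)] at this
    simp at this

/-- The walk can be reconstructed from its clauses. -/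
theorem unique (h : IsContradictory y s i j) (h' : IsContradictory z s i' j')
    (H : walkClauses y s = walkClauses z s) :
    i = i' ∧ j = j' ∧ ∀ t, 1 ≤ t → t ≤ s → y t = z t := by
  have := h.two_le; have := h.le; have := h.lt
  have := h'.two_le; have := h'.le; have := h'.lt
  have hi := h.start_eq h' H
  have hj := h.finish_eq h' H
  -- The clause `¬z j' ∨ ¬z s` contains `neg (y j)`; its other literal is negative, so it cannot be
  -- `y (j + 1)` and must be `neg (y s)`.
  have hs : y s = z s := by
    obtain ⟨D, hD, eD⟩ := h'.mem_of_le (t := s) le_rfl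
    rw [h'.finish, Finset.pair_comm, ← hj] at eD
    rw [← H] at hD
    rcases h.eq_of_mem_of_neg (by omega) (by omega) hD eD with e | ⟨-, e⟩
    · have := congrArg Prod.snd e
      rw [neg_snd, h.pos (j + 1) (by simp), h'.pos s (by simp)] at this
      simp at this
    · exact (neg_injective e).symm
  -- The walk is recovered backwards: the clause leading into `z t` determines the preceding
  -- literal. The only ambiguity is the chord at `t = i`, excluded since it would equate the
  -- positive `y 1` with the negative `neg (z (i' - 1))`.
  have hback : ∀ k, k < s → y (s - k) = z (s - k) := by
    intro k hk
    induction k with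
    | zero => exact hs
    | succ k ih =>
      have ih := ih (by omega)
      set t := s - k with ht
      obtain ⟨D, hD, eD⟩ := h'.mem_of_le (t := t - 1) (by omega)
      rw [Nat.sub_add_cancel (by omega), Finset.pair_comm, ← ih] at eD
      rw [← H] at hD
      rw [show s - (k + 1) = t - 1 by omega]
      rcases h.eq_of_mem (by omega) (by omega) hD eD with e | ⟨hti, e⟩
      · exact (neg_injective e).symm
      · have hti' : t = i' := h'.inj t i' (by omega) (by omega) (by omega) (by omega)
          (by rw [← ih, ← hi, hti])
        have := congrArg Prod.snd e
        rw [neg_snd, h.pos 1 (by simp), h'.pos (t - 1) (by rw [hti']; simp)] at this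
        simp at this
  have hall : ∀ t, 1 ≤ t → t ≤ s → y t = z t := fun t h1 h2 => by
    have := hback (s - t) (by omega)
    rwa [Nat.sub_sub_self h2] at this
  refine ⟨h'.inj _ _ (by omega) (by omega) (by omega) (by omega) ?_,
    h'.inj _ _ (by omega) (by omega) (by omega) (by omega) ?_, hall⟩
  · rw [← hall i (by omega) (by omega), hi]
  · rw [← hall j (by omega) (by omega), hj]

end IsContradictory

open Classical in
/-- The clause sets of the contradictory bicycles through `s` literals. -/
noncomputable def contradictorySets (n s : ℕ) : Finset (Finset (Clause n)) :=
  Finset.univ.filter fun S => ∃ y i j, IsContradictory y s i j ∧ S = walkClauses y s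

lemma mem_contradictorySets {s : ℕ} {S : Finset (Clause n)} :
    S ∈ contradictorySets n s ↔ ∃ y i j, IsContradictory y s i j ∧ S = walkClauses y s := by
  simp [contradictorySets]

/-- The admissible positions of the two chords, counted from `0`. -/
def chordPairs (s : ℕ) : Finset (Fin s × Fin s) :=
  Finset.univ.filter fun p => 1 ≤ p.1.1 ∧ p.1.1 ≤ p.2.1 ∧ p.2.1 + 2 ≤ s

lemma choose_le_card_chordPairs (k : ℕ) : (k + 2).choose 2 ≤ (chordPairs (k + 3)).card := by
  have h1 : ((Finset.range (k + 2)).sigma fun b => Finset.range b).card = (k + 2).choose 2 := by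
    rw [Finset.card_sigma]
    simp only [Finset.card_range]
    rw [Finset.sum_range_id, Nat.choose_two_right]
  rw [← h1]
  refine (Finset.card_le_card ?_).trans (Finset.card_image_le (s := chordPairs (k + 3))
    (f := fun p => (⟨p.2.1, p.1.1 - 1⟩ : Σ _ : ℕ, ℕ)))
  rintro ⟨b, a⟩ h
  simp only [Finset.mem_sigma, Finset.mem_range] at h
  refine Finset.mem_image.2 ⟨(⟨a + 1, by omega⟩, ⟨b, by omega⟩), ?_, rfl⟩
  simp only [chordPairs, Finset.mem_filter, Finset.mem_univ, true_and]
  omega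

/-- The sign patterns that are positive at the positions required of a contradictory bicycle. -/
def signPatterns (s : ℕ) (T : Finset ℕ) : Finset (Fin s → Bool) :=
  Fintype.piFinset fun t => if (t : ℕ) + 1 ∈ T then {true} else Finset.univ

lemma two_pow_le_card_signPatterns (s : ℕ) (T : Finset ℕ) :
    2 ^ s ≤ 2 ^ T.card * (signPatterns s T).card := by
  have h1 : (signPatterns s T).card = ∏ t : Fin s, if (t : ℕ) + 1 ∈ T then 1 else 2 := by
    rw [signPatterns, Fintype.card_piFinset]
    refine Finset.prod_congr rfl fun t _ => ?_
    split_ifs <;> simp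
  have h2 : ∏ t : Fin s, (if (t : ℕ) + 1 ∈ T then 2 else 1) ≤ 2 ^ T.card := by
    rw [Finset.prod_ite, Finset.prod_const, Finset.prod_const_one, mul_one]
    refine Nat.pow_le_pow_right (by norm_num) (Finset.card_le_card_of_injOn
      (fun t : Fin s => (t : ℕ) + 1) (fun t ht => by simpa using ht) fun t _ r _ e => ?_)
    simp only at e
    exact Fin.ext (by omega)
  calc 2 ^ s = (∏ t : Fin s, if (t : ℕ) + 1 ∈ T then 2 else 1) *
        ∏ t : Fin s, if (t : ℕ) + 1 ∈ T then 1 else 2 := by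
        rw [← Finset.prod_mul_distrib, Finset.prod_congr rfl (g := fun _ => 2)]
        · simp
        · intro t _
          split_ifs <;> rfl
    _ ≤ _ := by
        rw [h1]
        gcongr

lemma isContradictory_walkOf {s : ℕ} (e : Fin s ↪ Fin n) {σ : Fin s → Bool} {i j : Fin s}
    (h1 : 1 ≤ i.1) (h2 : i.1 ≤ j.1) (h3 : j.1 + 2 ≤ s)
    (hσ : σ ∈ signPatterns s {1, i.1 + 1 - 1, i.1 + 1, j.1 + 1, j.1 + 1 + 1, s}) :
    IsContradictory (walkOf e σ (neg (e i, σ i)) (neg (e j, σ j))) s (i + 1) (j + 1) := by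
  have hw : ∀ t, 1 ≤ t → t ≤ s → ∃ r : Fin s, t = r + 1 ∧
      walkOf e σ (neg (e i, σ i)) (neg (e j, σ j)) t = (e r, σ r) := by
    intro t t1 t2
    obtain ⟨r, rfl⟩ : ∃ r, t = r + 1 := ⟨t - 1, by omega⟩
    exact ⟨⟨r, by omega⟩, rfl, walkOf_succ e σ _ _ ⟨r, by omega⟩⟩
  refine ⟨?_, by omega, by omega, by omega, ?_, ?_, ?_⟩
  · intro t r t1 t2 r1 r2 h
    obtain ⟨t', rfl, et⟩ := hw t t1 t2
    obtain ⟨r', rfl, er⟩ := hw r r1 r2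
    rw [et, er] at h
    rw [e.injective h]
  · rw [walkOf_succ, walkOf_zero]
  · rw [walkOf_succ, walkOf_last]
  · intro t ht
    have h4 : 1 ≤ t ∧ t ≤ s := by
      simp only [Finset.mem_insert, Finset.mem_singleton] at ht
      omega
    obtain ⟨t', rfl, et⟩ := hw t h4.1 h4.2
    rw [et]
    have := Fintype.mem_piFinset.1 hσ t'
    rw [if_pos ht] at this
    simpa using this

/-- Chord positions, inner variables and signs can be chosen freely, apart from at most six
prescribed signs, which cost the factor `2 ^ 6 = 64`. Distinct choices give distinct clause sets by
`IsContradictory.unique`. -/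
lemma card_contradictorySets_ge (n k : ℕ) :
    (k + 2).choose 2 * n.descFactorial (k + 3) * 2 ^ (k + 3) ≤
      64 * (contradictorySets n (k + 3)).card := by
  set s := k + 3 with hs
  let T : Fin s × Fin s → Finset ℕ := fun p =>
    {1, p.1.1 + 1 - 1, p.1.1 + 1, p.2.1 + 1, p.2.1 + 1 + 1, s}
  let D : Finset (Σ _ : Fin s × Fin s, (Fin s ↪ Fin n) × (Fin s → Bool)) :=
    (chordPairs s).sigma fun p => Finset.univ ×ˢ signPatterns s (T p)
  have hD : (k + 2).choose 2 * n.descFactorial s * 2 ^ s ≤ 64 * D.card := by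
    calc (k + 2).choose 2 * n.descFactorial s * 2 ^ s
        ≤ (chordPairs s).card * (n.descFactorial s * 2 ^ s) := by
          rw [mul_assoc]
          exact Nat.mul_le_mul_right _ (choose_le_card_chordPairs k)
      _ = ∑ p ∈ chordPairs s, n.descFactorial s * 2 ^ s := by
          rw [Finset.sum_const, smul_eq_mul]
      _ ≤ ∑ p ∈ chordPairs s, n.descFactorial s * (64 * (signPatterns s (T p)).card) := by
          refine Finset.sum_le_sum fun p _ => Nat.mul_le_mul_left _ ?_
          refine (two_pow_le_card_signPatterns s (T p)).trans (Nat.mul_le_mul_right _ ?_)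
          exact (Nat.pow_le_pow_right (by norm_num) Finset.card_le_six).trans (by norm_num)
      _ = 64 * D.card := by
          rw [Finset.card_sigma, Finset.mul_sum]
          refine Finset.sum_congr rfl fun p _ => ?_
          rw [Finset.card_product, Finset.card_univ, Fintype.card_embedding_eq, Fintype.card_fin,
            Fintype.card_fin]
          ring
  refine hD.trans (Nat.mul_le_mul_left _ ?_)
  have hcon : ∀ x ∈ D, IsContradictory (walkOf x.2.1 x.2.2 (neg (x.2.1 x.1.1, x.2.2 x.1.1))
      (neg (x.2.1 x.1.2, x.2.2 x.1.2))) s (x.1.1 + 1) (x.1.2 + 1) := by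
    rintro ⟨⟨i, j⟩, e, σ⟩ hx
    simp only [D, Finset.mem_sigma, Finset.mem_product, Finset.mem_univ, true_and, chordPairs,
      Finset.mem_filter] at hx
    exact isContradictory_walkOf e hx.1.1 hx.1.2.1 hx.1.2.2 hx.2
  refine Finset.card_le_card_of_injOn (fun x => walkClauses (walkOf x.2.1 x.2.2
    (neg (x.2.1 x.1.1, x.2.2 x.1.1)) (neg (x.2.1 x.1.2, x.2.2 x.1.2))) s) ?_ ?_
  · intro x hx
    exact mem_contradictorySets.2 ⟨_, _, _, hcon x hx, rfl⟩
  · intro x hx x' hx' H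
    obtain ⟨h1, h2, h3⟩ := (hcon x hx).unique (hcon x' hx') H
    obtain ⟨⟨i, j⟩, e, σ⟩ := x
    obtain ⟨⟨i', j'⟩, e', σ'⟩ := x'
    simp only at h1 h2 h3
    obtain rfl : i = i' := Fin.ext (by omega)
    obtain rfl : j = j' := Fin.ext (by omega)
    have h4 : ∀ t : Fin s, (e t, σ t) = (e' t, σ' t) := fun t => by
      have := h3 (t + 1) (by omega) (by omega)
      rwa [walkOf_succ, walkOf_succ] at this
    obtain rfl : e = e' := DFunLike.ext _ _ fun t => (Prod.ext_iff.1 (h4 t)).1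
    obtain rfl : σ = σ' := funext fun t => (Prod.ext_iff.1 (h4 t)).2
    rfl

end Contradictory

/-! ### Second moment bound and overlaps of tight clause sets. -/

section SecondMoment

/-- By Bernoulli, the falling factorial is at least `(m - k) ^ k ≥ m ^ k * (1 - k ^ 2 / m)`. -/
lemma three_quarters_pow_le_descFactorial {m k L : ℕ} (hk : k ≤ L) (hL : 1 ≤ L)
    (hm : 4 * L ^ 2 ≤ m) : 3 / 4 * (m : ℝ) ^ k ≤ m.descFactorial k := by
  have hkL : k ^ 2 ≤ L ^ 2 := Nat.pow_le_pow_left hk 2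
  have hL2 : L ≤ L ^ 2 := Nat.le_self_pow (by norm_num) L
  have hm0 : (0 : ℝ) < m := by exact_mod_cast (by omega : 0 < m)
  have h1 : ((m : ℝ) - k) ^ k ≤ m.descFactorial k := by
    have h2 : ((m + 1 - k : ℕ) : ℝ) ^ k ≤ m.descFactorial k := by
      exact_mod_cast Nat.pow_sub_le_descFactorial m k
    refine le_trans ?_ h2
    have h3 : (k : ℝ) ≤ m := by exact_mod_cast (by omega : k ≤ m)
    rw [Nat.cast_sub (by omega)]
    push_cast
    gcongr
    all_goals linarith
  refine le_trans ?_ h1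
  have h4 : (4 : ℝ) * k ^ 2 ≤ m := by exact_mod_cast (by omega : 4 * k ^ 2 ≤ m)
  have h5 : (k : ℝ) ≤ m := by exact_mod_cast (by omega : k ≤ m)
  have h6 := one_add_mul_le_pow (a := -((k : ℝ) / m))
    (by rw [neg_le_neg_iff, div_le_iff₀ hm0]; linarith) k
  have h7 : ((m : ℝ) - k) ^ k = m ^ k * (1 + -((k : ℝ) / m)) ^ k := by
    rw [← mul_pow]
    congr 1
    field_simp
    ring
  have h8 : (3 : ℝ) / 4 ≤ 1 + k * -((k : ℝ) / m) := by
    have : (k : ℝ) * (k / m) ≤ 1 / 4 := by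
      rw [← mul_div_assoc, div_le_iff₀ hm0]
      nlinarith
    linarith
  rw [h7, mul_comm]
  gcongr
  exact h8.trans h6

section Bonferroni

variable {α : Type*} [Fintype α] [DecidableEq α]

/-- A second moment bound for the probability that one of the sets in `A` is covered. -/
lemma sum_coverProb_sub_le (m : ℕ) (A : Finset (Finset α)) :
    ∑ S ∈ A, coverProb m S - ∑ S ∈ A, ∑ T ∈ A.erase S, coverProb m (S ∪ T) ≤
      avg m fun F => if ∃ S ∈ A, Covers F S then 1 else 0 := by
  unfold coverProb
  simp only [← avg_sum]
  rw [← avg_sub]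
  refine avg_mono fun F => ?_
  set x : ℝ := ∑ S ∈ A, if Covers F S then 1 else 0 with hx
  -- With `x` covered sets there are `x ^ 2 - x` ordered pairs, and `x - (x ^ 2 - x) = 1 - (x - 1) ^
  -- 2` is at most 1, and is 0 when `x = 0`.
  have h1 : ∑ S ∈ A, ∑ T ∈ A.erase S, (if Covers F (S ∪ T) then (1 : ℝ) else 0) = x ^ 2 - x := by
    rw [sq, hx, Finset.sum_mul, ← Finset.sum_sub_distrib]
    refine Finset.sum_congr rfl fun S hS => ?_
    rw [← Finset.add_sum_erase A _ hS]
    by_cases h : Covers F S <;> simp [h, covers_union]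
  rw [h1]
  split_ifs with h
  · nlinarith [sq_nonneg (x - 1)]
  · have : x = 0 := Finset.sum_eq_zero fun S hS => if_neg fun hc => h ⟨S, hS, hc⟩
    rw [this]
    norm_num

end Bonferroni

variable {n : ℕ}

/-- There are more clauses than variables, but this fails for every proper subset. -/
def IsTight (S : Finset (Clause n)) : Prop :=
  (vars S).card + 1 ≤ S.card ∧ ∀ J, J ⊂ S → J.card ≤ (vars J).card

lemma IsBicycle.isTight {y : ℕ → Literal n} {s : ℕ} (h : IsBicycle y s) :
    IsTight (walkClauses y s) :=
  ⟨by rw [h.card_walkClauses]; exact Nat.succ_le_succ h.card_vars_le,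
    fun _ hJ => h.card_le_card_vars hJ⟩

/-- Tightness of `S` forbids `T ⊂ S`, so `T ∩ S` is a proper subset of `T` and has no surplus of
clauses over variables. The whole surplus of `T` therefore survives outside `S`. -/
lemma IsTight.card_vars_sdiff_lt {S T : Finset (Clause n)} (hS : IsTight S) (hT : IsTight T)
    (hne : T ≠ S) : (vars T \ vars S).card + 1 ≤ (T \ S).card := by
  have hss : T ∩ S ⊂ T := by
    refine Finset.ssubset_iff_subset_ne.2 ⟨Finset.inter_subset_left, fun e => ?_⟩
    have hTS : T ⊂ S := Finset.ssubset_iff_subset_ne.2 ⟨Finset.inter_eq_left.1 e, hne⟩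
    have h1 := hS.2 T hTS
    have h2 := hT.1
    omega
  have h1 := hT.2 _ hss
  have h2 : (vars (T ∩ S)).card ≤ (vars T ∩ vars S).card :=
    Finset.card_le_card (Finset.subset_inter (vars_mono Finset.inter_subset_left)
      (vars_mono Finset.inter_subset_right))
  have h3 := Finset.card_sdiff_add_card_inter T S
  have h4 := Finset.card_sdiff_add_card_inter (vars T) (vars S)
  have h5 := hT.1
  omega

/-- The number of clause sets whose variables lie in a given set is bounded. -/
lemma card_filter_vars_subset_le (A : Finset (Finset (Clause n))) (W : Finset (Fin n)) :
    (A.filter fun T => vars T ⊆ W).card ≤ 2 ^ 2 ^ (W.card * 2) := by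
  classical
  let Q : Finset (Clause n) := Finset.univ.filter fun C => C.1 ⊆ W ×ˢ Finset.univ
  have hQ : Q.card ≤ 2 ^ (W.card * 2) := by
    have : Q.card ≤ (W ×ˢ (Finset.univ : Finset Bool)).powerset.card :=
      Finset.card_le_card_of_injOn Subtype.val (fun C hC => Finset.mem_powerset.2
        (Finset.mem_filter.1 hC).2) Subtype.val_injective.injOn
    rwa [Finset.card_powerset, Finset.card_product, Finset.card_univ, Fintype.card_bool] at this
  have hA : (A.filter fun T => vars T ⊆ W) ⊆ Q.powerset := by
    intro T hT
    rw [Finset.mem_powerset]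
    intro C hC
    refine Finset.mem_filter.2 ⟨Finset.mem_univ _, fun l hl => ?_⟩
    exact Finset.mem_product.2 ⟨(Finset.mem_filter.1 hT).2 (mem_vars.2 ⟨C, hC, l, hl, rfl⟩),
      Finset.mem_univ _⟩
  refine (Finset.card_le_card hA).trans ?_
  rw [Finset.card_powerset]
  exact Nat.pow_le_pow_right (by norm_num) hQ

/-- For each size `r` there are at most `n ^ r` sets, contributing `(n * q) ^ r * q ≤ q`. -/
lemma sum_pow_card_add_one_le {q : ℝ} (hq : 0 ≤ q) (hnq : n * q ≤ 1) (K : ℕ) :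
    ∑ R ∈ (Finset.univ : Finset (Finset (Fin n))).filter (fun R => R.card ≤ K), q ^ (R.card + 1) ≤
      (K + 1) * q := by
  rw [← Finset.sum_fiberwise_of_maps_to' (t := Finset.range (K + 1)) (g := Finset.card)
    (fun R hR => Finset.mem_range.2 (Nat.lt_succ_iff.2 (Finset.mem_filter.1 hR).2))
    (fun r => q ^ (r + 1))]
  have : ∀ r ∈ Finset.range (K + 1), ∑ R ∈ ((Finset.univ : Finset (Finset (Fin n))).filter
      (fun R => R.card ≤ K)).filter (fun R => R.card = r), q ^ (r + 1) ≤ q := by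
    intro r _
    rw [Finset.sum_const, nsmul_eq_mul]
    have h1 : (((Finset.univ : Finset (Finset (Fin n))).filter
        (fun R => R.card ≤ K)).filter (fun R => R.card = r)).card ≤ n ^ r := by
      refine le_trans (Finset.card_le_card (t := Finset.powersetCard r Finset.univ) ?_) ?_
      · intro R hR
        simp only [Finset.mem_filter] at hR
        exact Finset.mem_powersetCard.2 ⟨Finset.subset_univ _, hR.2⟩
      · rw [Finset.card_powersetCard, Finset.card_univ, Fintype.card_fin]
        exact Nat.choose_le_pow n r
    calc _ ≤ ((n ^ r : ℕ) : ℝ) * q ^ (r + 1) := by gcongr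
      _ = (n * q) ^ r * q := by push_cast; ring
      _ ≤ 1 * q := by
        gcongr
        exact pow_le_one₀ (by positivity) hnq
      _ = q := one_mul q
  refine (Finset.sum_le_sum this).trans (le_of_eq ?_)
  simp

/-- Distinct tight sets overlap so little that the pairs are negligible. -/
lemma sum_pow_card_sdiff_le {A : Finset (Finset (Clause n))} {K : ℕ}
    (hA : ∀ S ∈ A, IsTight S ∧ (vars S).card ≤ K) {q : ℝ} (hq : 0 ≤ q) (hq1 : q ≤ 1)
    (hnq : n * q ≤ 1) {S : Finset (Clause n)} (hS : S ∈ A) :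
    ∑ T ∈ A.erase S, q ^ (T \ S).card ≤ 2 ^ 2 ^ (2 * K * 2) * ((K + 1) * q) := by
  have h1 : ∑ T ∈ A.erase S, q ^ (T \ S).card ≤
      ∑ T ∈ A.erase S, q ^ ((vars T \ vars S).card + 1) := by
    refine Finset.sum_le_sum fun T hT => pow_le_pow_of_le_one hq hq1 ?_
    exact (hA S hS).1.card_vars_sdiff_lt (hA T (Finset.mem_of_mem_erase hT)).1
      (Finset.ne_of_mem_erase hT)
  refine h1.trans ?_
  have hmaps : ∀ T ∈ A.erase S, vars T \ vars S ∈
      (Finset.univ : Finset (Finset (Fin n))).filter (fun R => R.card ≤ K) := fun T hT =>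
    Finset.mem_filter.2 ⟨Finset.mem_univ _, (Finset.card_le_card Finset.sdiff_subset).trans
      (hA T (Finset.mem_of_mem_erase hT)).2⟩
  -- The sets `T` are grouped by their new variables `R`. For fixed `R` they live on `vars S ∪ R`,
  -- at most `2 * K` variables, so their number is bounded independently of `n`.
  rw [← Finset.sum_fiberwise_of_maps_to' hmaps (fun R => q ^ (R.card + 1))]
  calc _ ≤ ∑ R ∈ (Finset.univ : Finset (Finset (Fin n))).filter (fun R => R.card ≤ K),
        2 ^ 2 ^ (2 * K * 2) * q ^ (R.card + 1) := by
        refine Finset.sum_le_sum fun R hR => ?_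
        rw [Finset.sum_const, nsmul_eq_mul]
        gcongr
        have h2 : ((A.erase S).filter fun T => vars T \ vars S = R) ⊆
            A.filter fun T => vars T ⊆ vars S ∪ R := by
          intro T hT
          obtain ⟨h3, h4⟩ := Finset.mem_filter.1 hT
          refine Finset.mem_filter.2 ⟨Finset.mem_of_mem_erase h3, ?_⟩
          rw [← h4, Finset.union_sdiff_self_eq_union]
          exact Finset.subset_union_right
        have h3 : (vars S ∪ R).card ≤ 2 * K := by
          refine (Finset.card_union_le _ _).trans ?_
          have := (hA S hS).2
          have := (Finset.mem_filter.1 hR).2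
          omega
        have h4 := (Finset.card_le_card h2).trans (card_filter_vars_subset_le A (vars S ∪ R))
        have h5 : 2 ^ 2 ^ ((vars S ∪ R).card * 2) ≤ 2 ^ 2 ^ (2 * K * 2) := by
          gcongr <;> norm_num
        exact_mod_cast h4.trans h5
    _ ≤ _ := by
        rw [← Finset.mul_sum]
        gcongr
        exact sum_pow_card_add_one_le hq hnq K

end SecondMoment

/-! ### The lower bound. -/

section LowerBound

variable {n : ℕ}

lemma avg_covers_le_card_sub_f (hn : 2 ≤ n) (m : ℕ) {A : Finset (Finset (Clause n))}
    (hA : ∀ S ∈ A, ∀ X : Fin n → Bool, ∃ C ∈ S, ¬Satisfies X C) :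
    avg m (fun F : Formula n m => if ∃ S ∈ A, Covers F S then (1 : ℝ) else 0) ≤
      (m : ℝ) - f n m := by
  rw [card_sub_f_eq_avg hn]
  refine avg_mono fun F => ?_
  have hle : ∀ X, numSat F X ≤ m := fun X => by
    have := numSat_add F X
    omega
  split_ifs with h
  · obtain ⟨S, hS, hF⟩ := h
    have hlt : ∀ X, numSat F X + 1 ≤ m := fun X => by
      obtain ⟨C, hC, hX⟩ := hA S hS X
      obtain ⟨i, hi⟩ := hF C hC
      have h1 : 0 < (Finset.univ.filter fun i => ¬Satisfies X (F i)).card :=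
        Finset.card_pos.2 ⟨i, Finset.mem_filter.2 ⟨Finset.mem_univ _, by rwa [hi]⟩⟩
      have := numSat_add F X
      omega
    have h1 : maxSat F ≤ m - 1 := Finset.sup_le fun X _ => by
      have := hlt X
      omega
    have h2 := hlt fun _ => true
    have h3 : maxSat F + 1 ≤ m := by omega
    have h4 : (maxSat F : ℝ) + 1 ≤ m := by exact_mod_cast h3
    linarith
  · have : maxSat F ≤ m := Finset.sup_le fun X _ => hle X
    exact sub_nonneg.2 (by exact_mod_cast this)

/-- The falling factorial and the correction in `le_coverProb` each lose at most a factor `3 / 4`,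
and `9 / 16 ≥ 1 / 2`. -/
lemma half_pow_le_coverProb {m L : ℕ} (hn : 2 ≤ n) {S : Finset (Clause n)}
    (hS : S.card ≤ L) (hL : 1 ≤ L) (hmL : 4 * L ^ 2 ≤ m) (hmn : m ≤ n)
    (hq : n * ((m : ℝ) / Fintype.card (Clause n)) ≤ 1) :
    1 / 2 * ((m : ℝ) / Fintype.card (Clause n)) ^ S.card ≤ coverProb m S := by
  have := nonempty_clause hn
  refine le_trans ?_ (le_coverProb m S)
  have h1 := three_quarters_pow_le_descFactorial hS hL hmL
  set q : ℝ := (m : ℝ) / Fintype.card (Clause n) with hqd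
  have hq0 : 0 ≤ q := by positivity
  have h2 : 3 / 4 * q ^ S.card ≤
      (m.descFactorial S.card : ℝ) / (Fintype.card (Clause n) : ℝ) ^ S.card := by
    rw [hqd, div_pow, ← mul_div_assoc]
    gcongr
  have h3 : (3 : ℝ) / 4 ≤ 1 - S.card * m / Fintype.card (Clause n) := by
    rw [mul_div_assoc, ← hqd]
    have h4 : 4 * S.card ≤ n := by
      have : L ≤ L ^ 2 := Nat.le_self_pow (by norm_num) L
      omega
    have h5 : (4 : ℝ) * S.card ≤ n := by exact_mod_cast h4
    nlinarith
  calc 1 / 2 * q ^ S.card ≤ 3 / 4 * q ^ S.card * (3 / 4) := by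
        have : 0 ≤ q ^ S.card := by positivity
        linarith
    _ ≤ _ := by gcongr

/-- The clause sets of the contradictory bicycles through `3, …, K + 2` literals. -/
noncomputable def smallContradictorySets (n K : ℕ) : Finset (Finset (Clause n)) :=
  (Finset.range K).biUnion fun k => contradictorySets n (k + 3)

lemma mem_smallContradictorySets {K : ℕ} {S : Finset (Clause n)}
    (hS : S ∈ smallContradictorySets n K) :
    IsTight S ∧ (vars S).card ≤ K + 2 ∧ S.card ≤ K + 3 ∧
      ∀ X : Fin n → Bool, ∃ C ∈ S, ¬Satisfies X C := by
  obtain ⟨k, hk, hS⟩ := Finset.mem_biUnion.1 hS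
  obtain ⟨y, i, j, h, rfl⟩ := mem_contradictorySets.1 hS
  rw [Finset.mem_range] at hk
  refine ⟨h.isBicycle.isTight, h.isBicycle.card_vars_le.trans (by omega), ?_,
    h.exists_not_satisfies⟩
  rw [h.isBicycle.card_walkClauses]
  omega

lemma sum_pow_smallContradictorySets (K : ℕ) (q : ℝ) :
    ∑ S ∈ smallContradictorySets n K, q ^ S.card =
      ∑ k ∈ Finset.range K, ((contradictorySets n (k + 3)).card : ℝ) * q ^ (k + 4) := by
  have hcard : ∀ s, ∀ S ∈ contradictorySets n s, S.card = s + 1 := by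
    intro s S hS
    obtain ⟨y, i, j, h, rfl⟩ := mem_contradictorySets.1 hS
    exact h.isBicycle.card_walkClauses
  rw [smallContradictorySets, Finset.sum_biUnion]
  · refine Finset.sum_congr rfl fun k _ => ?_
    rw [Finset.sum_congr rfl fun S hS => by rw [hcard _ S hS], Finset.sum_const, nsmul_eq_mul]
  · intro k _ l _ hkl
    refine Finset.disjoint_left.2 fun S h1 h2 => hkl ?_
    have h3 := hcard _ S h1
    have h4 := hcard _ S h2
    omega

/-- The constant is `3 / 4` from the falling factorial, `1 / 64` from the prescribed signs, and `1 /
2` because there is one more clause than variables and at most `2 * n ^ 2` clauses exist. -/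
lemma expected_contradictorySets_ge {m K k : ℕ} (hn : 2 ≤ n) (hk : k < K)
    (hmK : 4 * (K + 3) ^ 2 ≤ n) :
    3 / 512 / n * (((k + 2).choose 2 : ℕ) * ((m : ℝ) / n) ^ (k + 4)) ≤
      ((contradictorySets n (k + 3)).card : ℝ) *
        ((m : ℝ) / Fintype.card (Clause n)) ^ (k + 4) := by
  have := nonempty_clause hn
  have hn0 : (0 : ℝ) < n := by exact_mod_cast (by omega : 0 < n)
  have h1 : (((k + 2).choose 2 : ℕ) : ℝ) * n.descFactorial (k + 3) * 2 ^ (k + 3) ≤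
      64 * (contradictorySets n (k + 3)).card := by
    exact_mod_cast card_contradictorySets_ge n k
  have h2 := three_quarters_pow_le_descFactorial (m := n) (k := k + 3) (L := K + 3) (by omega)
    (by omega) hmK
  have h3 : (m : ℝ) / n / (2 * n) ≤ (m : ℝ) / Fintype.card (Clause n) := by
    rw [div_div]
    have h4 : (0 : ℝ) < Fintype.card (Clause n) := by exact_mod_cast Fintype.card_pos
    gcongr
    have h5 : Fintype.card (Clause n) ≤ n * (2 * n) := by
      rw [card_clause, mul_comm n, mul_assoc, mul_assoc]
      gcongr
      exact Nat.sub_le n 1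
    exact_mod_cast h5
  set x : ℝ := (m : ℝ) / n
  have hx : 0 ≤ x := by positivity
  calc 3 / 512 / n * (((k + 2).choose 2 : ℕ) * x ^ (k + 4))
      = (((k + 2).choose 2 : ℕ) * (3 / 4 * (n : ℝ) ^ (k + 3)) * 2 ^ (k + 3) / 64) *
          (x / (2 * n)) ^ (k + 4) := by
        rw [div_pow x (2 * n : ℝ), mul_pow]
        field_simp
        ring
    _ ≤ (((k + 2).choose 2 : ℕ) * (n.descFactorial (k + 3) : ℝ) * 2 ^ (k + 3) / 64) *
          ((m : ℝ) / Fintype.card (Clause n)) ^ (k + 4) := by gcongr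
    _ ≤ _ := by
        gcongr
        linarith

/-- Each small contradictory set contributes at least `1 / 2 * q ^ S.card` to the first moment, and
its pairs take away at most half of that, since `q ≤ 1 / n` and `n` exceeds the doubly exponential
overlap constant. -/
theorem le_card_sub_f {m K : ℕ} (hmn : m ≤ n) (hmK : 4 * (K + 3) ^ 2 ≤ m)
    (hnK : 4 * (2 ^ 2 ^ (2 * (K + 2) * 2) * (K + 3)) ≤ n) :
    3 / 2048 / n * ∑ k ∈ Finset.range K, (((k + 2).choose 2 : ℕ) * ((m : ℝ) / n) ^ (k + 4)) ≤
      (m : ℝ) - f n m := by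
  have hn : 2 ≤ n := by nlinarith
  have hn0 : (2 : ℝ) ≤ n := by exact_mod_cast hn
  have := nonempty_clause hn
  set q : ℝ := (m : ℝ) / Fintype.card (Clause n) with hqd
  have hq0 : 0 ≤ q := by positivity
  have hnq : n * q ≤ 1 := by
    rw [hqd, card_clause]
    push_cast [Nat.cast_sub (by omega : 1 ≤ n)]
    have h1 : (m : ℝ) ≤ n := by exact_mod_cast hmn
    have h2 : (0 : ℝ) < n - 1 := by linarith
    rw [← mul_div_assoc, div_le_one (by positivity)]
    nlinarith
  have hq1 : q ≤ 1 := by nlinarith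
  set A := smallContradictorySets n K with hAd
  set B : ℝ := 2 ^ 2 ^ (2 * (K + 2) * 2) * (((K + 2 : ℕ) : ℝ) + 1) with hB
  have hBq : B * q ≤ 1 / 4 := by
    have h1 : 4 * B ≤ n := by
      rw [hB]
      have : (4 : ℝ) * (2 ^ 2 ^ (2 * (K + 2) * 2) * (K + 3)) ≤ n := by exact_mod_cast hnK
      push_cast
      linarith
    nlinarith
  have hpair : ∀ S ∈ A, ∑ T ∈ A.erase S, coverProb m (S ∪ T) ≤ 1 / 4 * q ^ S.card := by
    intro S hS
    calc ∑ T ∈ A.erase S, coverProb m (S ∪ T)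
        ≤ ∑ T ∈ A.erase S, q ^ (T \ S).card * q ^ S.card := by
          refine Finset.sum_le_sum fun T _ => ?_
          rw [← pow_add, Finset.card_sdiff_add_card, Finset.union_comm]
          exact coverProb_le m _
      _ = (∑ T ∈ A.erase S, q ^ (T \ S).card) * q ^ S.card := by rw [Finset.sum_mul]
      _ ≤ 1 / 4 * q ^ S.card := by
          gcongr
          refine (sum_pow_card_sdiff_le (K := K + 2) (fun T hT => ?_) hq0 hq1 hnq hS).trans ?_
          · have := mem_smallContradictorySets hT
            exact ⟨this.1, this.2.1⟩
          · rwa [← mul_assoc]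
  have hsum : 1 / 4 * ∑ S ∈ A, q ^ S.card ≤ (m : ℝ) - f n m := by
    refine le_trans ?_ (avg_covers_le_card_sub_f hn m (A := A) fun S hS =>
      (mem_smallContradictorySets hS).2.2.2)
    refine le_trans ?_ (sum_coverProb_sub_le m A)
    rw [← Finset.sum_sub_distrib, Finset.mul_sum]
    refine Finset.sum_le_sum fun S hS => ?_
    have h1 := hpair S hS
    have h2 := half_pow_le_coverProb hn (mem_smallContradictorySets hS).2.2.1 (by omega) hmK hmn hnq
    linarith
  refine le_trans ?_ hsum
  rw [hAd, sum_pow_smallContradictorySets, Finset.mul_sum, Finset.mul_sum]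
  refine Finset.sum_le_sum fun k hk => ?_
  have h1 := expected_contradictorySets_ge (m := m) hn (Finset.mem_range.1 hk) (hmK.trans hmn)
  calc 3 / 2048 / (n : ℝ) * (((k + 2).choose 2 : ℕ) * ((m : ℝ) / n) ^ (k + 4))
      = 1 / 4 * (3 / 512 / n * (((k + 2).choose 2 : ℕ) * ((m : ℝ) / n) ^ (k + 4))) := by ring
    _ ≤ _ := by gcongr

lemma eventually_le_card_sub_f {ε : ℝ} (h0 : 0 < ε) (h1 : ε < 1) :
    ∀ᶠ n : ℕ in Filter.atTop, 3 / 8192 * (1 - ε) ^ 4 * (1 / (ε ^ 3 * (n : ℝ))) ≤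
      (⌊(1 - ε) * (n : ℝ)⌋₊ : ℝ) - f n ⌊(1 - ε) * (n : ℝ)⌋₊ := by
  set c : ℝ := 1 - ε with hc
  have hc0 : 0 < c := by linarith
  have hε3 : 0 < 1 / ε ^ 3 := by positivity
  have hsum := hasSum_choose_mul_geometric_of_norm_lt_one (𝕜 := ℝ) 2 (r := c)
    (by rw [Real.norm_of_nonneg hc0.le]; linarith)
  rw [hc, sub_sub_cancel, ← hc] at hsum
  -- The truncation `K` depends on `ε` only and keeps more than half of the series.
  obtain ⟨K, hK⟩ := (hsum.tendsto_sum_nat.eventually_const_lt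
    (show 1 / 2 * (1 / ε ^ 3) < 1 / ε ^ (2 + 1) by
      rw [show 2 + 1 = 3 from rfl]
      linarith)).exists
  let P : ℝ → ℝ := fun x => ∑ k ∈ Finset.range K, (((k + 2).choose 2 : ℕ) * x ^ (k + 4))
  have hP : Continuous P := by fun_prop
  -- Weakening `1 / 2` to `1 / 4` makes the inequality strict, so it persists by continuity when `c`
  -- is replaced by `⌊c * n⌋ / n` for large `n`.
  have hPc : 1 / 4 * c ^ 4 * (1 / ε ^ 3) < P c := by
    have h2 : P c = c ^ 4 * ∑ k ∈ Finset.range K, (((k + 2).choose 2 : ℕ) * c ^ k) := by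
      rw [Finset.mul_sum]
      exact Finset.sum_congr rfl fun k _ => by ring
    rw [h2]
    have h3 : 0 < c ^ 4 := by positivity
    nlinarith [mul_pos h3 hε3]
  have hx : Filter.Tendsto (fun n : ℕ => ((⌊c * (n : ℝ)⌋₊ : ℕ) : ℝ) / n) Filter.atTop (nhds c) :=
    (tendsto_nat_floor_mul_div_atTop hc0.le).comp tendsto_natCast_atTop_atTop
  have hm : Filter.Tendsto (fun n : ℕ => ⌊c * (n : ℝ)⌋₊) Filter.atTop Filter.atTop :=
    (tendsto_nat_floor_mul_atTop c hc0).comp tendsto_natCast_atTop_atTop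
  filter_upwards [((hP.tendsto c).comp hx).eventually_const_lt hPc,
    hm.eventually_ge_atTop (4 * (K + 3) ^ 2),
    Filter.eventually_ge_atTop (4 * (2 ^ 2 ^ (2 * (K + 2) * 2) * (K + 3)))] with n hn1 hn2 hn3
  have hmn : ⌊c * (n : ℝ)⌋₊ ≤ n := by
    refine Nat.floor_le_of_le ?_
    have : (0 : ℝ) ≤ n := Nat.cast_nonneg n
    nlinarith
  refine le_trans ?_ (le_card_sub_f hmn hn2 hn3)
  calc 3 / 8192 * c ^ 4 * (1 / (ε ^ 3 * (n : ℝ)))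
      = 3 / 2048 / n * (1 / 4 * c ^ 4 * (1 / ε ^ 3)) := by
        rw [← one_div_mul_one_div]
        ring
    _ ≤ _ := by
        gcongr
        exact hn1.le

end LowerBound

end Max2Sat

theorem mainTheorem4 :
    ∃ A : ℝ, 0 < A ∧ ∀ ε₁ : ℝ, 0 < ε₁ → ε₁ < 1 →
      ∃ a : ℝ, 0 < a ∧ ∀ ε : ℝ, 0 < ε → ε ≤ ε₁ →
        ∃ n₀ : ℕ, ∀ n : ℕ, n₀ ≤ n →
          a * (1 / (ε ^ 3 * (n : ℝ))) ≤
              (⌊(1 - ε) * (n : ℝ)⌋₊ : ℝ) - Max2Sat.f n ⌊(1 - ε) * (n : ℝ)⌋₊ ∧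
            (⌊(1 - ε) * (n : ℝ)⌋₊ : ℝ) - Max2Sat.f n ⌊(1 - ε) * (n : ℝ)⌋₊ ≤
              A * (1 / (ε ^ 3 * (n : ℝ))) := by
  -- The lower constant `3 / 8192 * (1 - ε) ^ 4` decreases in `ε`, so its value at `ε₁` serves for
  -- all `ε ≤ ε₁`.
  refine ⟨16, by norm_num, fun ε₁ h0 h1 => ⟨3 / 8192 * (1 - ε₁) ^ 4, ?_, fun ε hε0 hε1 => ?_⟩⟩
  · have : 0 < 1 - ε₁ := by linarith
    positivity
  obtain ⟨n₀, hn₀⟩ := Filter.eventually_atTop.1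
    (Max2Sat.eventually_le_card_sub_f hε0 (hε1.trans_lt h1))
  refine ⟨max n₀ 2, fun n hn => ⟨?_, ?_⟩⟩
  · refine le_trans ?_ (hn₀ n ((le_max_left _ _).trans hn))
    gcongr
  · refine Max2Sat.sub_f_le ((le_max_right _ _).trans hn) hε0 (hε1.trans h1.le)
      (Nat.floor_le (mul_nonneg ?_ (Nat.cast_nonneg n)))
    linarith
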